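/- Let $K$ be a field and let $E=(E^0,E^1,s,r)$ be an arbitrary directed graph, with vertex set $E^0$, edge set $E^1$, source map $s$ and range map $r$. The Leavitt path algebra $L_K(E)$ is the associative (not necessarily unital) $K$-algebra generated by the vertices $u\in E^0$, the edges $e\in E^1$ and symbols $e^*$ ($e\in E^1$), subject to the relations, for all $u,u'\in E^0$ and $e,f\in E^1$: (1) $uu'=\delta_{u,u'}u'$; (2) $s(e)e=e=e\,r(e)$ and $e^*s(e)=e^*=r(e)e^*$; (3) $e^*f=\delta_{e,f}\,r(e)$; (4) $u=\sum_{e\in s^{-1}(u)}ee^*$ whenever $0<|s^{-1}(u)|<\infty$. Let $n$ be a positive integer, let $v,w\in E^0$ (possibly equal), and let $e_1,\dots,e_n$ be distinct edges with $s(e_i)=v$ and $r(e_i)=w$ for all $i$. Let $P=(p_{i,j})$ and $Q=(q_{i,j})$ be $n\times n$ matrices over $L_K(E)$ such that $wP=Pw$, $wQ=Qw$ and $wPQ=wQP=wI_n$, where $wM$ and $Mw$ are obtained from $M$ by multiplying every entry by $w$ on the left, respectively on the right, and $wI_n$ has $w$ on the diagonal and $0$ elsewhere. Then: (i) There is a unique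 homomorphism of (not necessarily unital) $K$-algebras $\varphi_{P,Q}\colon L_K(E)\to L_K(E)$ such that $\varphi_{P,Q}(u)=u$ for all $u\in E^0$, $\varphi_{P,Q}(e)=e$ and $\varphi_{P,Q}(e^*)=e^*$ for all $e\in E^1\setminus\{e_1,\dots,e_n\}$, and $$\varphi_{P,Q}(e_i)=\sum_{k=1}^n e_kp_{k,i},\qquad \varphi_{P,Q}(e_i^*)=\sum_{k=1}^n q_{i,k}e_k^*\qquad(1\le i\le n).$$ Since the hypotheses are symmetric in $P$ and $Q$, the homomorphism $\varphi_{Q,P}$ is defined in the same way, with $P$ and $Q$ interchanged. (ii) If $w\varphi_{P,Q}(p_{i,j})=wp_{i,j}$ for all $1\le i,j\le n$, or $w\varphi_{P,Q}(q_{i,j})=wq_{i,j}$ for all $1\le i,j\le n$, then $\varphi_{P,Q}$ is an isomorphism, and $\varphi_{P,Q}^{-1}=\varphi_{Q,P}$. -/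

import Mathlib

open scoped BigOperators

universe uK uV uE uA

/-- A directed graph with vertex set `V`, edge set `E`, source map `s` and range map `r`. -/
structure DirectedGraph (V : Type uV) (E : Type uE) where
  s : E → V
  r : E → V

namespace LeavittPathAlgebra

/-- The generators: vertices `v`, edges `e`, and formal symbols `e*` (ghost edges). -/
inductive Generator (V : Type uV) (E : Type uE) : Type (max uV uE)
  | vert : V → Generator V E
  | edge : E → Generator V E
  | ghost : E → Generator V E

/-- The free associative, not necessarily unital, `K`-algebra on the generators: the semigroup
algebra of the free semigroup (nonempty words). -/
abbrev FreeAlg (K : Type uK) [Field K] (V : Type uV) (E : Type uE) :=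
  MonoidAlgebra K (FreeSemigroup (Generator V E))

/-- A generator as an element of the free algebra. -/
noncomputable def FreeAlg.gen (K : Type uK) [Field K] {V : Type uV} {E : Type uE}
    (x : Generator V E) : FreeAlg K V E :=
  MonoidAlgebra.single (FreeSemigroup.of x) 1

open FreeAlg Generator in
/-- The smallest `K`-algebra congruence on the free algebra that contains the defining relations
of the Leavitt path algebra. -/
inductive Rel (K : Type uK) [Field K] {V : Type uV} {E : Type uE} (G : DirectedGraph V E) :
    FreeAlg K V E → FreeAlg K V E → Prop
  -- relation (1): `v w = δ_{v,w} w`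
  | vert_mul_self (v : V) : Rel K G (gen K (vert v) * gen K (vert v)) (gen K (vert v))
  | vert_mul_of_ne (v w : V) (h : v ≠ w) : Rel K G (gen K (vert v) * gen K (vert w)) 0
  -- relation (2): `s(e) e = e = e r(e)` and `e* s(e) = e* = r(e) e*`
  | source_mul (e : E) : Rel K G (gen K (vert (G.s e)) * gen K (edge e)) (gen K (edge e))
  | mul_range (e : E) : Rel K G (gen K (edge e) * gen K (vert (G.r e))) (gen K (edge e))
  | ghost_mul_source (e : E) :
      Rel K G (gen K (ghost e) * gen K (vert (G.s e))) (gen K (ghost e))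
  | range_mul_ghost (e : E) :
      Rel K G (gen K (vert (G.r e)) * gen K (ghost e)) (gen K (ghost e))
  -- relation (3): `e* f = δ_{e,f} r(e)`
  | ghost_mul_self (e : E) : Rel K G (gen K (ghost e) * gen K (edge e)) (gen K (vert (G.r e)))
  | ghost_mul_of_ne (e f : E) (h : e ≠ f) : Rel K G (gen K (ghost e) * gen K (edge f)) 0
  -- relation (4): `v = ∑_{s(e) = v} e e*` if `v` emits at least one and only finitely many edges
  | vert_eq_sum (v : V) (hne : {e : E | G.s e = v}.Nonempty) (hfin : {e : E | G.s e = v}.Finite) :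
      Rel K G (gen K (vert v)) (∑ e ∈ hfin.toFinset, gen K (edge e) * gen K (ghost e))
  -- closure under the operations of an equivalence relation and of a `K`-algebra
  | refl (a : FreeAlg K V E) : Rel K G a a
  | symm {a b : FreeAlg K V E} : Rel K G a b → Rel K G b a
  | trans {a b c : FreeAlg K V E} : Rel K G a b → Rel K G b c → Rel K G a c
  | add {a b c d : FreeAlg K V E} : Rel K G a b → Rel K G c d → Rel K G (a + c) (b + d)
  | mul {a b c d : FreeAlg K V E} : Rel K G a b → Rel K G c d → Rel K G (a * c) (b * d)
  | smul (k : K) {a b : FreeAlg K V E} : Rel K G a b → Rel K G (k • a) (k • b)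

/-- `Rel` as a bundled ring congruence. -/
def con (K : Type uK) [Field K] {V : Type uV} {E : Type uE} (G : DirectedGraph V E) :
    RingCon (FreeAlg K V E) where
  r := Rel K G
  iseqv := ⟨Rel.refl, Rel.symm, Rel.trans⟩
  add' := Rel.add
  mul' := Rel.mul

end LeavittPathAlgebra

/-- The Leavitt path algebra `L_K(E)`, a not necessarily unital associative `K`-algebra. -/
def LeavittPathAlgebra (K : Type uK) [Field K] {V : Type uV} {E : Type uE}
    (G : DirectedGraph V E) : Type (max uK uV uE) :=
  (LeavittPathAlgebra.con K G).Quotient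

namespace LeavittPathAlgebra

noncomputable instance (K : Type uK) [Field K] {V : Type uV} {E : Type uE}
    (G : DirectedGraph V E) : NonUnitalRing (LeavittPathAlgebra K G) :=
  inferInstanceAs (NonUnitalRing (con K G).Quotient)

/-- The quotient map from the free algebra. -/
noncomputable def mk (K : Type uK) [Field K] {V : Type uV} {E : Type uE} (G : DirectedGraph V E)
    (a : FreeAlg K V E) : LeavittPathAlgebra K G :=
  (con K G).toQuotient a

noncomputable instance (K : Type uK) [Field K] {V : Type uV} {E : Type uE}
    (G : DirectedGraph V E) : SMul K (LeavittPathAlgebra K G) where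
  smul k := Quotient.map' (k • ·) fun _ _ h => Rel.smul k h

noncomputable instance (K : Type uK) [Field K] {V : Type uV} {E : Type uE}
    (G : DirectedGraph V E) : Module K (LeavittPathAlgebra K G) where
  one_smul := by rintro ⟨a⟩; exact congrArg (mk K G) (one_smul K a)
  mul_smul := by rintro k l ⟨a⟩; exact congrArg (mk K G) (mul_smul k l a)
  smul_zero k := congrArg (mk K G) (smul_zero k)
  smul_add := by rintro k ⟨a⟩ ⟨b⟩; exact congrArg (mk K G) (smul_add k a b)
  add_smul := by rintro k l ⟨a⟩; exact congrArg (mk K G) (add_smul k l a)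
  zero_smul := by rintro ⟨a⟩; exact congrArg (mk K G) (zero_smul K a)

instance (K : Type uK) [Field K] {V : Type uV} {E : Type uE} (G : DirectedGraph V E) :
    IsScalarTower K (LeavittPathAlgebra K G) (LeavittPathAlgebra K G) where
  smul_assoc := by rintro k ⟨a⟩ ⟨b⟩; exact congrArg (mk K G) (smul_mul_assoc k a b)

instance (K : Type uK) [Field K] {V : Type uV} {E : Type uE} (G : DirectedGraph V E) :
    SMulCommClass K (LeavittPathAlgebra K G) (LeavittPathAlgebra K G) where
  smul_comm := by rintro k ⟨a⟩ ⟨b⟩; exact congrArg (mk K G) (mul_smul_comm k a b).symm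

/-- The vertex `v` as an element of `L_K(E)`. -/
noncomputable def vert (K : Type uK) [Field K] {V : Type uV} {E : Type uE} (G : DirectedGraph V E)
    (v : V) : LeavittPathAlgebra K G :=
  mk K G (FreeAlg.gen K (Generator.vert v))

/-- The edge `e` as an element of `L_K(E)`. -/
noncomputable def edge (K : Type uK) [Field K] {V : Type uV} {E : Type uE} (G : DirectedGraph V E)
    (e : E) : LeavittPathAlgebra K G :=
  mk K G (FreeAlg.gen K (Generator.edge e))

/-- The ghost edge `e*` as an element of `L_K(E)`. -/
noncomputable def ghost (K : Type uK) [Field K] {V : Type uV} {E : Type uE} (G : DirectedGraph V E)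
    (e : E) : LeavittPathAlgebra K G :=
  mk K G (FreeAlg.gen K (Generator.ghost e))

/-- The conditions that characterise `φ_{P,Q}`: it fixes all vertices, all edges other than the
`e_i` and their ghost edges, and maps `e_i ↦ ∑ₖ e_k p_{k,i}` and `e_i* ↦ ∑ₖ q_{i,k} e_k*`. -/
structure IsPhi {K : Type uK} [Field K] {V : Type uV} {E : Type uE} {G : DirectedGraph V E}
    {n : ℕ} (e : Fin n → E) (P Q : Matrix (Fin n) (Fin n) (LeavittPathAlgebra K G))
    (φ : LeavittPathAlgebra K G →ₙₐ[K] LeavittPathAlgebra K G) : Prop where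
  map_vert : ∀ u : V, φ (vert K G u) = vert K G u
  map_edge : ∀ f : E, f ∉ Set.range e → φ (edge K G f) = edge K G f
  map_ghost : ∀ f : E, f ∉ Set.range e → φ (ghost K G f) = ghost K G f
  map_edge_apply : ∀ i : Fin n, φ (edge K G (e i)) = ∑ k, edge K G (e k) * P k i
  map_ghost_apply : ∀ i : Fin n, φ (ghost K G (e i)) = ∑ k, Q i k * ghost K G (e k)

/-- The scalar matrix `a Iₙ`, with `a` on the diagonal and `0` elsewhere. For a matrix `M`, the
products `aM` and `Ma` are `(a Iₙ) M` and `M (a Iₙ)`. -/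
def scalarMatrix {R : Type uA} [Zero R] (n : ℕ) (a : R) : Matrix (Fin n) (Fin n) R :=
  Matrix.diagonal fun _ => a

end LeavittPathAlgebra

/-! Existence and uniqueness in (i) come from the universal property of `L_K(E)`: the proposed
images satisfy relations (1)-(4), because `P` and `Q` commute with `w` and are inverse to each other
over the corner `w L w` (`exists_isPhi`).

For (ii), write `φ = φ_{P,Q}` and `ψ = φ_{Q,P}`. If `φ` fixes the entries of one matrix, it fixes
those of the inverse matrix (`map_inverse_entry`). A computation on the generators then gives `φ ∘ ψ
= id` (`IsPhi.comp_eq_id`), so `φ` is onto. The other composite cannot be computed in this way,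
because nothing is known about `ψ` on the entries. Instead, every surjective endomorphism that fixes
the vertices is injective (`injective_of_surjective`), and `ψ ∘ φ = id` follows.

To see the injectivity, let `x ≠ 0` lie in the kernel. Multiplying `x` on both sides gives `z = k u
+ (closed paths at u)` with `k ≠ 0` (`exists_mul_mul_eq`). If some path `l` from `u` to `t` were a
prefix of none of the words `m l`, for `m` in the support of `z`, then `l* z l = k t` would lie in
the kernel, although `φ(t) = t ≠ 0`. So every path from `u` is a prefix of a power of one of
finitely many closed paths. Combinatorics of words then shows that any two paths from `u` are
comparable, so `u` lies on a cycle `c` without exits and `u L u` is spanned by the `cⁱ (c*)ʲ`. Now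
`φ` kills a polynomial in `c` with nonzero constant term. Hence `φ(K[c])` is finite-dimensional and
contains `φ(c*)`, so `φ(u L u)` is finite-dimensional. By surjectivity it contains the
infinite-dimensional `K[c]`, a contradiction (`map_ne_zero_of_cycle`). -/

namespace LeavittPathAlgebra

/-! ### Relations between the generators of `L_K(E)`. -/

section Generators

variable (K : Type uK) [Field K] {V : Type uV} {E : Type uE} (G : DirectedGraph V E)

/-- The quotient map from the free algebra as a homomorphism. -/
noncomputable def mkHom : FreeAlg K V E →ₙₐ[K] LeavittPathAlgebra K G where
  toFun := mk K G
  map_smul' _ _ := rfl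
  map_zero' := rfl
  map_add' _ _ := rfl
  map_mul' _ _ := rfl

theorem mkHom_surjective : Function.Surjective (mkHom K G) := by
  rintro ⟨a⟩
  exact ⟨a, rfl⟩

variable {K G}

theorem mkHom_eq {a b : FreeAlg K V E} (h : Rel K G a b) : mkHom K G a = mkHom K G b :=
  Quotient.sound h

variable (K G)

theorem vert_mul_vert_self (v : V) : vert K G v * vert K G v = vert K G v := by
  have h := mkHom_eq (G := G) (Rel.vert_mul_self (K := K) v)
  rwa [map_mul] at h

theorem vert_mul_vert_of_ne {v w : V} (hvw : v ≠ w) : vert K G v * vert K G w = 0 := by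
  have h := mkHom_eq (G := G) (Rel.vert_mul_of_ne (K := K) v w hvw)
  rwa [map_mul, map_zero] at h

theorem vert_source_mul_edge (e : E) : vert K G (G.s e) * edge K G e = edge K G e := by
  have h := mkHom_eq (Rel.source_mul (K := K) (G := G) e)
  rwa [map_mul] at h

theorem edge_mul_vert_range (e : E) : edge K G e * vert K G (G.r e) = edge K G e := by
  have h := mkHom_eq (Rel.mul_range (K := K) (G := G) e)
  rwa [map_mul] at h

theorem ghost_mul_vert_source (e : E) : ghost K G e * vert K G (G.s e) = ghost K G e := by
  have h := mkHom_eq (Rel.ghost_mul_source (K := K) (G := G) e)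
  rwa [map_mul] at h

theorem vert_range_mul_ghost (e : E) : vert K G (G.r e) * ghost K G e = ghost K G e := by
  have h := mkHom_eq (Rel.range_mul_ghost (K := K) (G := G) e)
  rwa [map_mul] at h

theorem ghost_mul_edge_self (e : E) : ghost K G e * edge K G e = vert K G (G.r e) := by
  have h := mkHom_eq (Rel.ghost_mul_self (K := K) (G := G) e)
  rwa [map_mul] at h

theorem ghost_mul_edge_of_ne {e f : E} (hef : e ≠ f) : ghost K G e * edge K G f = 0 := by
  have h := mkHom_eq (Rel.ghost_mul_of_ne (K := K) (G := G) e f hef)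
  rwa [map_mul, map_zero] at h

theorem vert_eq_sum (v : V) (hne : {e : E | G.s e = v}.Nonempty)
    (hfin : {e : E | G.s e = v}.Finite) :
    vert K G v = ∑ e ∈ hfin.toFinset, edge K G e * ghost K G e := by
  have h := mkHom_eq (Rel.vert_eq_sum (K := K) (G := G) v hne hfin)
  simp only [map_sum, map_mul] at h
  exact h

theorem edge_mul_vert_of_ne {v : V} {e : E} (h : G.r e ≠ v) : edge K G e * vert K G v = 0 := by
  rw [← edge_mul_vert_range, mul_assoc, vert_mul_vert_of_ne K G h, mul_zero]

theorem ghost_mul_vert_of_ne {v : V} {e : E} (h : G.s e ≠ v) : ghost K G e * vert K G v = 0 := by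
  rw [← ghost_mul_vert_source, mul_assoc, vert_mul_vert_of_ne K G h, mul_zero]

theorem vert_mul_ghost_of_ne {v : V} {e : E} (h : v ≠ G.r e) : vert K G v * ghost K G e = 0 := by
  rw [← vert_range_mul_ghost, ← mul_assoc, vert_mul_vert_of_ne K G h, zero_mul]

/-- A submodule that contains the generators and is stable under left multiplication by them
is everything. -/
theorem eq_top_of_gen_mem (S : Submodule K (LeavittPathAlgebra K G))
    (hvert : ∀ v, vert K G v ∈ S) (hedge : ∀ e, edge K G e ∈ S) (hghost : ∀ e, ghost K G e ∈ S)
    (hvert_mul : ∀ v, ∀ x ∈ S, vert K G v * x ∈ S)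
    (hedge_mul : ∀ e, ∀ x ∈ S, edge K G e * x ∈ S)
    (hghost_mul : ∀ e, ∀ x ∈ S, ghost K G e * x ∈ S) : S = ⊤ := by
  have key : ∀ x : FreeSemigroup (Generator V E),
      mkHom K G (MonoidAlgebra.single x 1) ∈ S := by
    intro x
    induction x using FreeSemigroup.recOnMul with
    | ih1 x => cases x with
      | vert v => exact hvert v
      | edge e => exact hedge e
      | ghost e => exact hghost e
    | ih2 x y hx hy =>
      have : (MonoidAlgebra.single (FreeSemigroup.of x * y) 1 : FreeAlg K V E) =
          FreeAlg.gen K x * MonoidAlgebra.single y 1 := by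
        simp [FreeAlg.gen, MonoidAlgebra.single_mul_single]
      rw [this, map_mul]
      cases x with
      | vert v => exact hvert_mul v _ hy
      | edge e => exact hedge_mul e _ hy
      | ghost e => exact hghost_mul e _ hy
  rw [eq_top_iff]
  rintro x -
  obtain ⟨a, rfl⟩ := mkHom_surjective K G x
  induction a using MonoidAlgebra.induction_linear with
  | zero => rw [map_zero]; exact S.zero_mem
  | add a b ha hb => rw [map_add]; exact S.add_mem ha hb
  | single x k =>
    have : (MonoidAlgebra.single x k : FreeAlg K V E) = k • MonoidAlgebra.single x 1 := by
      simp
    rw [this]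
    exact S.smul_mem k (key x)

variable {K G}

/-- A homomorphism on `L_K(E)` is determined by its values on the generators. -/
theorem hom_ext {A : Type uA} [NonUnitalRing A] [Module K A]
    {φ ψ : LeavittPathAlgebra K G →ₙₐ[K] A}
    (hvert : ∀ v, φ (vert K G v) = ψ (vert K G v)) (hedge : ∀ e, φ (edge K G e) = ψ (edge K G e))
    (hghost : ∀ e, φ (ghost K G e) = ψ (ghost K G e)) : φ = ψ := by
  let S : Submodule K (LeavittPathAlgebra K G) :=
    { carrier := {x | φ x = ψ x}
      add_mem' := fun {a b} ha hb => by
        change φ (a + b) = ψ (a + b)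
        rw [map_add, map_add, show φ a = ψ a from ha, show φ b = ψ b from hb]
      zero_mem' := by
        change φ 0 = ψ 0
        rw [map_zero, map_zero]
      smul_mem' := fun c a ha => by
        change φ (c • a) = ψ (c • a)
        rw [map_smul, map_smul, show φ a = ψ a from ha] }
  have hS : S = ⊤ := by
    refine eq_top_of_gen_mem K G S hvert hedge hghost ?_ ?_ ?_
    · intro v x hx
      change φ _ = ψ _
      rw [map_mul, map_mul, hvert, show φ x = ψ x from hx]
    · intro v x hx
      change φ _ = ψ _
      rw [map_mul, map_mul, hedge, show φ x = ψ x from hx]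
    · intro v x hx
      change φ _ = ψ _
      rw [map_mul, map_mul, hghost, show φ x = ψ x from hx]
  ext x
  have : x ∈ S := hS ▸ Submodule.mem_top
  exact this

end Generators

/-! ### The universal property. -/

/-- Elements of an algebra that satisfy the defining relations of the Leavitt path algebra. -/
structure LeavittFamily {V : Type uV} {E : Type uE} (G : DirectedGraph V E) (A : Type uA)
    [NonUnitalRing A] where
  vert : V → A
  edge : E → A
  ghost : E → A
  vert_mul_self : ∀ v, vert v * vert v = vert v
  vert_mul_of_ne : ∀ v w, v ≠ w → vert v * vert w = 0
  source_mul : ∀ e, vert (G.s e) * edge e = edge e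
  mul_range : ∀ e, edge e * vert (G.r e) = edge e
  ghost_mul_source : ∀ e, ghost e * vert (G.s e) = ghost e
  range_mul_ghost : ∀ e, vert (G.r e) * ghost e = ghost e
  ghost_mul_self : ∀ e, ghost e * edge e = vert (G.r e)
  ghost_mul_of_ne : ∀ e f, e ≠ f → ghost e * edge f = 0
  vert_eq_sum : ∀ (v : V), {e : E | G.s e = v}.Nonempty → ∀ hfin : {e : E | G.s e = v}.Finite,
    vert v = ∑ e ∈ hfin.toFinset, edge e * ghost e

namespace LeavittFamily

variable {K : Type uK} [Field K] {V : Type uV} {E : Type uE} {G : DirectedGraph V E}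
  {A : Type uA} [NonUnitalRing A] [Module K A] [IsScalarTower K A A] [SMulCommClass K A A]
  (F : LeavittFamily G A)

/-- The values of a Leavitt family on the generators. -/
def onGenerator : Generator V E → A
  | .vert v => F.vert v
  | .edge e => F.edge e
  | .ghost e => F.ghost e

variable (K) in
/-- The homomorphism on the free algebra given by a Leavitt family. -/
noncomputable def freeLift : FreeAlg K V E →ₙₐ[K] A :=
  MonoidAlgebra.liftMagma K (FreeSemigroup.lift F.onGenerator)

theorem freeLift_gen (x : Generator V E) : F.freeLift K (FreeAlg.gen K x) = F.onGenerator x := by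
  simp [freeLift, FreeAlg.gen]

theorem freeLift_eq {a b : FreeAlg K V E} (h : Rel K G a b) :
    F.freeLift K a = F.freeLift K b := by
  induction h with
  | vert_mul_self v => simp only [map_mul, freeLift_gen]; exact F.vert_mul_self v
  | vert_mul_of_ne v w h =>
    simp only [map_mul, map_zero, freeLift_gen]; exact F.vert_mul_of_ne v w h
  | source_mul e => simp only [map_mul, freeLift_gen]; exact F.source_mul e
  | mul_range e => simp only [map_mul, freeLift_gen]; exact F.mul_range e
  | ghost_mul_source e => simp only [map_mul, freeLift_gen]; exact F.ghost_mul_source e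
  | range_mul_ghost e => simp only [map_mul, freeLift_gen]; exact F.range_mul_ghost e
  | ghost_mul_self e => simp only [map_mul, freeLift_gen]; exact F.ghost_mul_self e
  | ghost_mul_of_ne e f h =>
    simp only [map_mul, map_zero, freeLift_gen]; exact F.ghost_mul_of_ne e f h
  | vert_eq_sum v hne hfin =>
    simp only [map_mul, map_sum, freeLift_gen]; exact F.vert_eq_sum v hne hfin
  | refl a => rfl
  | symm _ ih => exact ih.symm
  | trans _ _ ih₁ ih₂ => exact ih₁.trans ih₂
  | add _ _ ih₁ ih₂ => rw [map_add, map_add, ih₁, ih₂]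
  | mul _ _ ih₁ ih₂ => rw [map_mul, map_mul, ih₁, ih₂]
  | smul k _ ih => rw [map_smul, map_smul, ih]

variable (K) in
/-- The homomorphism on `L_K(E)` given by a Leavitt family. -/
noncomputable def lift : LeavittPathAlgebra K G →ₙₐ[K] A where
  toFun := Quotient.lift (F.freeLift K) fun _ _ h => F.freeLift_eq h
  map_smul' := by rintro k ⟨a⟩; exact map_smul (F.freeLift K) k a
  map_zero' := map_zero (F.freeLift K)
  map_add' := by rintro ⟨a⟩ ⟨b⟩; exact map_add (F.freeLift K) a b
  map_mul' := by rintro ⟨a⟩ ⟨b⟩; exact map_mul (F.freeLift K) a b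

theorem lift_vert (v : V) : F.lift K (LeavittPathAlgebra.vert K G v) = F.vert v :=
  F.freeLift_gen (.vert v)

theorem lift_edge (e : E) : F.lift K (LeavittPathAlgebra.edge K G e) = F.edge e :=
  F.freeLift_gen (.edge e)

theorem lift_ghost (e : E) : F.lift K (LeavittPathAlgebra.ghost K G e) = F.ghost e :=
  F.freeLift_gen (.ghost e)

end LeavittFamily

end LeavittPathAlgebra

namespace LeavittPathAlgebra

/-! ### A graded representation from a branching system. -/

section Representation

variable (K : Type uK) [Field K] {V : Type uV} {E : Type uE} (G : DirectedGraph V E)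

/-- A decomposition of a set `X`, for every vertex `v` that is not a sink, into copies of `X`
indexed by the edges with source `v`. -/
structure BranchingSystem (X : Type*) where
  cons : E → X → X
  head : V → X → Option E
  tail : V → X → X
  head_cons : ∀ e x, head (G.s e) (cons e x) = some e
  tail_cons : ∀ e x, tail (G.s e) (cons e x) = x
  exists_head : ∀ e x, ∃ f, G.s f = G.s e ∧ head (G.s e) x = some f ∧
    cons f (tail (G.s e) x) = x

/-- The set `ℕ ⊕ E` is infinite and at least as large as each `s⁻¹(v)`, so it is in bijection with
`s⁻¹(v) × (ℕ ⊕ E)` whenever `v` is not a sink. The values of `head` and `tail` at sinks are junk: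
the axioms only concern vertices `G.s e`. -/
theorem nonempty_branchingSystem : Nonempty (BranchingSystem G (ℕ ⊕ E)) := by
  classical
  have h : ∀ v : V, {e : E | G.s e = v}.Nonempty →
      Nonempty ((ℕ ⊕ E) ≃ {e : E | G.s e = v} × (ℕ ⊕ E)) := by
    intro v hv
    rw [← Cardinal.eq, Cardinal.mk_prod, Cardinal.lift_id, Cardinal.lift_id]
    refine (Cardinal.mul_eq_right (Cardinal.aleph0_le_mk _) ?_ ?_).symm
    · exact Cardinal.mk_le_of_injective (f := fun e => Sum.inr e.1) fun a b hab =>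
        Subtype.ext (Sum.inr_injective hab)
    · have := hv.to_subtype
      exact Cardinal.mk_ne_zero _
  let σ := fun v hv => (h v hv).some
  refine ⟨⟨fun e x => (σ (G.s e) ⟨e, rfl⟩).symm (⟨e, rfl⟩, x),
    fun v x => if hv : {e : E | G.s e = v}.Nonempty then some (σ v hv x).1 else none,
    fun v x => if hv : {e : E | G.s e = v}.Nonempty then (σ v hv x).2 else x, ?_, ?_, ?_⟩⟩
  · intro e x
    have hv : {f : E | G.s f = G.s e}.Nonempty := ⟨e, rfl⟩
    simp only [hv, dif_pos, Equiv.apply_symm_apply]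
  · intro e x
    have hv : {f : E | G.s f = G.s e}.Nonempty := ⟨e, rfl⟩
    simp only [hv, dif_pos, Equiv.apply_symm_apply]
  · intro e x
    have hv : {f : E | G.s f = G.s e}.Nonempty := ⟨e, rfl⟩
    -- The vertex is a variable here so that the equation `G.s f = v` carried by the edge can be
    -- eliminated with `rfl`.
    have key : ∀ (v : V) (hv : {f : E | G.s f = v}.Nonempty) (y : {f : E | G.s f = v} × (ℕ ⊕ E))
        (hv' : {f : E | G.s f = G.s y.1.1}.Nonempty),
        (σ (G.s y.1.1) hv').symm (⟨y.1.1, rfl⟩, y.2) = (σ v hv).symm y := by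
      rintro v hv ⟨⟨f, rfl⟩, y⟩ hv'
      rfl
    refine ⟨(σ (G.s e) hv x).1, (σ (G.s e) hv x).1.2, ?_, ?_⟩
    · simp only [hv, dif_pos]
    · simp only [hv, dif_pos]
      rw [key (G.s e) hv _ ⟨_, rfl⟩, Equiv.symm_apply_apply]

variable {G} {X : Type*} (B : BranchingSystem G X)

namespace BranchingSystem

open Classical in
/-- The action of a vertex on functions. -/
noncomputable def vertOp (v : V) : Module.End K (V × X × ℤ → K) where
  toFun h b := if b.1 = v then h b else 0
  map_add' h h' := by ext b; by_cases hb : b.1 = v <;> simp [hb]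
  map_smul' k h := by ext b; by_cases hb : b.1 = v <;> simp [hb]

open Classical in
/-- The action of an edge on functions. -/
noncomputable def edgeOp (e : E) : Module.End K (V × X × ℤ → K) where
  -- On point masses this is `(r(e), x, m) ↦ (s(e), cons e x, m + 1)`; the integer records the
  -- degree.
  toFun h b := if b.1 = G.s e ∧ B.head b.1 b.2.1 = some e then
    h (G.r e, B.tail b.1 b.2.1, b.2.2 - 1) else 0
  map_add' h h' := by ext b; simp only [Pi.add_apply]; split_ifs <;> simp
  map_smul' k h := by ext b; simp only [Pi.smul_apply]; split_ifs <;> simp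

open Classical in
/-- The action of a ghost edge on functions. -/
noncomputable def ghostOp (e : E) : Module.End K (V × X × ℤ → K) where
  toFun h b := if b.1 = G.r e then h (G.s e, B.cons e b.2.1, b.2.2 + 1) else 0
  map_add' h h' := by ext b; simp only [Pi.add_apply]; split_ifs <;> simp
  map_smul' k h := by ext b; simp only [Pi.smul_apply]; split_ifs <;> simp

/-- The representation of the Leavitt path algebra given by a branching system. -/
noncomputable def family : LeavittFamily G (Module.End K (V × X × ℤ → K)) where
  vert := vertOp K
  edge := B.edgeOp K
  ghost := B.ghostOp K
  vert_mul_self v := by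
    ext h b
    by_cases hb : b.1 = v <;> simp [vertOp, hb]
  vert_mul_of_ne v w hvw := by
    apply LinearMap.ext; intro h; ext b
    by_cases hb : b.1 = v <;> simp [vertOp, hb, hvw]
  source_mul e := by
    apply LinearMap.ext; intro h; ext b
    by_cases hb : b.1 = G.s e <;> simp [vertOp, edgeOp, hb]
  mul_range e := by
    apply LinearMap.ext; intro h; ext b
    by_cases hb : b.1 = G.s e <;> simp [vertOp, edgeOp, hb]
  ghost_mul_source e := by
    apply LinearMap.ext; intro h; ext b
    by_cases hb : b.1 = G.r e <;> simp [vertOp, ghostOp, hb]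
  range_mul_ghost e := by
    apply LinearMap.ext; intro h; ext b
    by_cases hb : b.1 = G.r e <;> simp [vertOp, ghostOp, hb]
  ghost_mul_self e := by
    apply LinearMap.ext; intro h; ext ⟨v, x, m⟩
    by_cases hb : v = G.r e <;> simp [vertOp, edgeOp, ghostOp, hb, B.head_cons, B.tail_cons]
  ghost_mul_of_ne e f hef := by
    apply LinearMap.ext; intro h; ext ⟨v, x, m⟩
    by_cases hb : v = G.r e <;> simp [edgeOp, ghostOp, hb, B.head_cons, hef]
  vert_eq_sum v hne hfin := by
    obtain ⟨e, rfl⟩ := hne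
    apply LinearMap.ext; intro h; ext ⟨v, x, m⟩
    simp only [LinearMap.sum_apply, Finset.sum_apply, Module.End.mul_apply]
    by_cases hb : v = G.s e
    · subst hb
      -- Only the edge that is the head of `x` contributes to the sum.
      obtain ⟨f, hf, hhead, hcons⟩ := B.exists_head e x
      rw [Finset.sum_eq_single f]
      · simp [vertOp, edgeOp, ghostOp, hf, hhead, hcons]
      · intro f' _ hf'
        simp [edgeOp, hhead, hf'.symm]
      · intro hmem
        exact absurd (by simpa using hf) hmem
    · rw [Finset.sum_eq_zero]
      · simp [vertOp, hb]
      · intro f hf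
        have hf' : G.s f = G.s e := by simpa using hf
        simp [edgeOp, hf', hb]

theorem vertOp_single [DecidableEq V] [DecidableEq X] (v : V) (b : V × X × ℤ) (hb : b.1 = v) :
    vertOp K v (Pi.single b 1) = Pi.single b 1 := by
  ext b'
  by_cases h : b' = b
  · subst h; simp [vertOp, hb]
  · simp [vertOp, h]

theorem edgeOp_single [DecidableEq V] [DecidableEq X] (e : E) (x : X) (m : ℤ) :
    B.edgeOp K e (Pi.single (G.r e, x, m) 1) = Pi.single (G.s e, B.cons e x, m + 1) 1 := by
  ext ⟨v, y, l⟩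
  by_cases hv : v = G.s e
  · subst hv
    obtain ⟨f, hf, hhead, hcons⟩ := B.exists_head e y
    by_cases hfe : f = e
    · subst hfe
      have h1 : (B.tail (G.s f) y = x) ↔ y = B.cons f x :=
        ⟨fun h => by rw [← h, hcons], fun h => by rw [h, B.tail_cons]⟩
      simp [edgeOp, hhead, Pi.single_apply, h1, sub_eq_iff_eq_add]
    · have h1 : y ≠ B.cons e x := by
        rintro rfl
        rw [B.head_cons] at hhead
        exact hfe (Option.some_injective _ hhead).symm
      simp [edgeOp, hhead, hfe, h1]
  · simp [edgeOp, hv]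

end BranchingSystem

end Representation

/-! ### Paths, ghost paths and linear independence. -/

section Paths

variable (K : Type uK) [Field K] {V : Type uV} {E : Type uE} (G : DirectedGraph V E)

/-- The product of a list of edges, ending in the vertex `u`. -/
noncomputable def pathElt (u : V) : List E → LeavittPathAlgebra K G
  | [] => vert K G u
  | e :: l => edge K G e * pathElt u l

/-- The product of the ghost edges of a list of edges in the opposite order, starting from the
vertex `u`. -/
noncomputable def ghostElt (u : V) : List E → LeavittPathAlgebra K G
  | [] => vert K G u
  | e :: l => ghostElt u l * ghost K G e

/-- The source of a path that ends in `u`. -/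
def pathSource (u : V) : List E → V
  | [] => u
  | e :: _ => G.s e

/-- A list of edges is a path that ends in `u`. -/
def IsPathTo (u : V) : List E → Prop
  | [] => True
  | e :: l => G.r e = pathSource G u l ∧ IsPathTo u l

variable {G}

theorem pathSource_append (u : V) (l m : List E) :
    pathSource G u (l ++ m) = pathSource G (pathSource G u m) l := by
  cases l <;> rfl

theorem isPathTo_append {u : V} {l m : List E} :
    IsPathTo G u (l ++ m) ↔ IsPathTo G (pathSource G u m) l ∧ IsPathTo G u m := by
  induction l with
  | nil => simp [IsPathTo]
  | cons e l ih => simp [IsPathTo, ih, pathSource_append, and_assoc]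

theorem pathElt_append (u : V) (l m : List E) :
    pathElt K G u (l ++ m) = pathElt K G (pathSource G u m) l * pathElt K G u m := by
  induction l with
  | nil =>
    cases m with
    | nil => exact (vert_mul_vert_self K G u).symm
    | cons e m =>
      simp only [List.nil_append, pathElt, pathSource, ← mul_assoc, vert_source_mul_edge]
  | cons e l ih => simp [pathElt, ih, mul_assoc]

theorem ghostElt_append (u : V) (l m : List E) :
    ghostElt K G u (l ++ m) = ghostElt K G u m * ghostElt K G (pathSource G u m) l := by
  induction l with
  | nil =>
    cases m with
    | nil => exact (vert_mul_vert_self K G u).symm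
    | cons e m => simp only [List.nil_append, ghostElt, pathSource, mul_assoc, ghost_mul_vert_source]
  | cons e l ih => simp [ghostElt, ih, mul_assoc]

theorem pathElt_mul_vert (u : V) (l : List E) :
    pathElt K G u l * vert K G u = pathElt K G u l := by
  induction l with
  | nil => exact vert_mul_vert_self K G u
  | cons e l ih => rw [pathElt, mul_assoc, ih]

theorem vert_mul_ghostElt (u : V) (l : List E) :
    vert K G u * ghostElt K G u l = ghostElt K G u l := by
  induction l with
  | nil => exact vert_mul_vert_self K G u
  | cons e l ih => rw [ghostElt, ← mul_assoc, ih]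

theorem pathElt_mul_vert_of_ne {u v : V} (h : u ≠ v) (l : List E) :
    pathElt K G u l * vert K G v = 0 := by
  rw [← pathElt_mul_vert, mul_assoc, vert_mul_vert_of_ne K G h, mul_zero]

theorem vert_mul_pathElt (u : V) (l : List E) :
    vert K G (pathSource G u l) * pathElt K G u l = pathElt K G u l := by
  rw [← List.nil_append l, pathElt_append, ← mul_assoc]
  simp only [List.nil_append, pathElt, vert_mul_vert_self]

theorem ghostElt_mul_vert (u : V) (l : List E) :
    ghostElt K G u l * vert K G (pathSource G u l) = ghostElt K G u l := by
  rw [← List.nil_append l, ghostElt_append, mul_assoc]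
  simp only [List.nil_append, ghostElt, vert_mul_vert_self]

theorem vert_mul_pathElt_of_ne {u v : V} {l : List E} (h : v ≠ pathSource G u l) :
    vert K G v * pathElt K G u l = 0 := by
  rw [← vert_mul_pathElt, ← mul_assoc, vert_mul_vert_of_ne K G h, zero_mul]

theorem ghostElt_mul_vert_of_ne {u v : V} {l : List E} (h : pathSource G u l ≠ v) :
    ghostElt K G u l * vert K G v = 0 := by
  rw [← ghostElt_mul_vert, mul_assoc, vert_mul_vert_of_ne K G h, mul_zero]

/-- This lets spans range over all lists of edges instead of paths. -/
theorem pathElt_eq_zero {u : V} {l : List E} (h : ¬ IsPathTo G u l) : pathElt K G u l = 0 := by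
  induction l with
  | nil => exact absurd trivial h
  | cons e l ih =>
    by_cases hl : IsPathTo G u l
    · have hne : G.r e ≠ pathSource G u l := fun h' => h ⟨h', hl⟩
      rw [pathElt, ← vert_mul_pathElt, ← mul_assoc, edge_mul_vert_of_ne K G hne, zero_mul]
    · rw [pathElt, ih hl, mul_zero]

theorem ghostElt_eq_zero {u : V} {l : List E} (h : ¬ IsPathTo G u l) : ghostElt K G u l = 0 := by
  induction l with
  | nil => exact absurd trivial h
  | cons e l ih =>
    by_cases hl : IsPathTo G u l
    · have hne : pathSource G u l ≠ G.r e := fun h' => h ⟨h'.symm, hl⟩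
      rw [ghostElt, ← ghostElt_mul_vert, mul_assoc, vert_mul_ghost_of_ne K G hne, mul_zero]
    · rw [ghostElt, ih hl, zero_mul]

theorem ghostElt_mul_pathElt_self {u : V} {l : List E} (h : IsPathTo G u l) :
    ghostElt K G u l * pathElt K G u l = vert K G u := by
  induction l with
  | nil => exact vert_mul_vert_self K G u
  | cons e l ih =>
    rw [ghostElt, pathElt, mul_assoc, ← mul_assoc (ghost K G e), ghost_mul_edge_self, h.1,
      vert_mul_pathElt, ih h.2]

/-- The product of a ghost path with an edge path that it does not divide. -/
theorem ghostElt_mul_pathElt_of_not_prefix {u t : V} {l m : List E} (hlm : l.length ≤ m.length)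
    (h : ¬ l <+: m) : ghostElt K G u l * pathElt K G t m = 0 := by
  induction l generalizing m with
  | nil => exact absurd List.nil_prefix h
  | cons e l ih =>
    cases m with
    -- The length bound excludes this case, in which a nonzero ghost path could remain.
    | nil => simp at hlm
    | cons f m =>
      rw [ghostElt, pathElt, mul_assoc, ← mul_assoc (ghost K G e)]
      by_cases hef : e = f
      · subst hef
        rw [ghost_mul_edge_self]
        have h' : ¬ l <+: m := fun h' => h (by simpa using h')
        by_cases hr : G.r e = pathSource G t m
        · rw [hr, vert_mul_pathElt, ih (by simpa using hlm) h']
        · rw [vert_mul_pathElt_of_ne K hr, mul_zero]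
      · rw [ghost_mul_edge_of_ne K G hef, zero_mul, mul_zero]

/-- Monomials in the paths and ghost paths span the Leavitt path algebra. -/
theorem span_pathElt_mul_ghostElt : Submodule.span K
    (Set.range fun x : V × List E × List E => pathElt K G x.1 x.2.1 * ghostElt K G x.1 x.2.2) =
      ⊤ := by
  set S := Submodule.span K
    (Set.range fun x : V × List E × List E => pathElt K G x.1 x.2.1 * ghostElt K G x.1 x.2.2)
    with hS
  have hmem : ∀ t l m, pathElt K G t l * ghostElt K G t m ∈ S := fun t l m =>
    Submodule.subset_span ⟨(t, l, m), rfl⟩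
  have hext : ∀ a : LeavittPathAlgebra K G,
      (∀ t l m, a * (pathElt K G t l * ghostElt K G t m) ∈ S) → ∀ x ∈ S, a * x ∈ S := by
    intro a ha x hx
    refine Submodule.span_induction (p := fun x _ => a * x ∈ S) ?_ ?_ ?_ ?_ hx
    · rintro _ ⟨⟨t, l, m⟩, rfl⟩
      exact ha t l m
    · rw [mul_zero]; exact S.zero_mem
    · intro x y _ _ hx hy
      rw [mul_add]; exact S.add_mem hx hy
    · intro k x _ hx
      rw [mul_smul_comm]; exact S.smul_mem k hx
  refine eq_top_of_gen_mem K G S ?_ ?_ ?_ ?_ ?_ ?_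
  · intro v
    simpa [pathElt, ghostElt, vert_mul_vert_self] using hmem v [] []
  · intro e
    simpa [pathElt, ghostElt, edge_mul_vert_range] using hmem (G.r e) [e] []
  · intro e
    simpa [pathElt, ghostElt, vert_range_mul_ghost] using hmem (G.r e) [] [e]
  · intro v
    refine hext _ fun t l m => ?_
    rw [← mul_assoc]
    by_cases hv : v = pathSource G t l
    · rw [hv, vert_mul_pathElt]; exact hmem t l m
    · rw [vert_mul_pathElt_of_ne K hv, zero_mul]; exact S.zero_mem
  · intro e
    refine hext _ fun t l m => ?_
    rw [← mul_assoc]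
    exact hmem t (e :: l) m
  · intro e
    refine hext _ fun t l m => ?_
    rw [← mul_assoc]
    cases l with
    | nil =>
      by_cases ht : G.s e = t
      · subst ht
        -- `ghostElt` reverses its list, so a ghost edge on the left is appended at the end.
        have h : ghost K G e * pathElt K G (G.s e) [] * ghostElt K G (G.s e) m =
            pathElt K G (G.r e) [] * ghostElt K G (G.r e) (m ++ [e]) := by
          rw [ghostElt_append]
          simp [pathElt, ghostElt, pathSource, vert_range_mul_ghost, ghost_mul_vert_source,
            ← mul_assoc]
        rw [h]; exact hmem _ _ _
      · rw [pathElt, ghost_mul_vert_of_ne K G ht, zero_mul]; exact S.zero_mem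
    | cons f l =>
      rw [pathElt, ← mul_assoc]
      by_cases hef : e = f
      · subst hef
        rw [ghost_mul_edge_self]
        by_cases hr : G.r e = pathSource G t l
        · rw [hr, vert_mul_pathElt]; exact hmem t l m
        · rw [vert_mul_pathElt_of_ne K hr, zero_mul]; exact S.zero_mem
      · rw [ghost_mul_edge_of_ne K G hef, zero_mul, zero_mul]; exact S.zero_mem

/-- The image of a base point under the action of a path in a branching system. -/
def BranchingSystem.pathPoint {X : Type*} (B : BranchingSystem G X) (u : V) (x : X) :
    List E → V × X × ℤ
  | [] => (u, x, 0)
  | e :: l => (G.s e, B.cons e (B.pathPoint u x l).2.1, (B.pathPoint u x l).2.2 + 1)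

theorem BranchingSystem.pathPoint_snd_snd {X : Type*} (B : BranchingSystem G X) (u : V) (x : X)
    (l : List E) : (B.pathPoint u x l).2.2 = l.length := by
  induction l with
  | nil => rfl
  | cons e l ih => simp [pathPoint, ih]

theorem BranchingSystem.pathPoint_fst {X : Type*} (B : BranchingSystem G X) (u : V) (x : X)
    (l : List E) : (B.pathPoint u x l).1 = pathSource G u l := by
  cases l <;> rfl

/-- `head` recovers the first edge and `tail` the point of the remaining path. Equal lengths are
assumed because `x` may itself have a head; in the application the integer coordinate supplies them.
-/
theorem BranchingSystem.pathPoint_injective {X : Type*} (B : BranchingSystem G X) (u : V) (x : X)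
    {l m : List E} (h1 : (B.pathPoint u x l).1 = (B.pathPoint u x m).1)
    (h2 : (B.pathPoint u x l).2.1 = (B.pathPoint u x m).2.1) (h3 : l.length = m.length)
    (hl : IsPathTo G u l) (hm : IsPathTo G u m) : l = m := by
  induction l generalizing m with
  | nil => exact (List.length_eq_zero_iff.mp h3.symm).symm
  | cons e l ih =>
    cases m with
    | nil => simp at h3
    | cons f m =>
      simp only [pathPoint] at h1 h2
      have hef : e = f := by
        have := B.head_cons e (B.pathPoint u x l).2.1
        rw [h1, h2, B.head_cons] at this
        exact (Option.some_injective _ this).symm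
      subst hef
      have h2' := congrArg (B.tail (G.s e)) h2
      rw [B.tail_cons, B.tail_cons] at h2'
      rw [ih ?_ h2' (by simpa using h3) hl.2 hm.2]
      rw [B.pathPoint_fst, B.pathPoint_fst, ← hl.1, ← hm.1]

/-- The paths that end in a given vertex are linearly independent. -/
theorem linearIndependent_pathElt (u : V) :
    LinearIndependent K fun l : {l : List E // IsPathTo G u l} => pathElt K G u l.1 := by
  classical
  obtain ⟨B⟩ := nonempty_branchingSystem G
  let x : ℕ ⊕ E := Sum.inl 0
  -- Acting on one point mass sends distinct paths to distinct point masses, which are linearly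
  -- independent.
  let f : LeavittPathAlgebra K G →ₗ[K] (V × (ℕ ⊕ E) × ℤ → K) :=
    { toFun := fun a => (B.family K).lift K a (Pi.single (u, x, 0) 1)
      map_add' := fun a b => by rw [map_add]; rfl
      map_smul' := fun k a => by rw [map_smul]; rfl }
  have hf : ∀ l : List E, IsPathTo G u l →
      f (pathElt K G u l) = Pi.single (B.pathPoint u x l) 1 := by
    intro l hl
    change (B.family K).lift K (pathElt K G u l) (Pi.single (u, x, 0) 1) = _
    induction l with
    | nil =>
      rw [pathElt, LeavittFamily.lift_vert]
      exact BranchingSystem.vertOp_single K u (u, x, 0) rfl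
    | cons e l ih =>
      rw [pathElt, map_mul, LeavittFamily.lift_edge, Module.End.mul_apply, ih hl.2]
      have h := B.edgeOp_single K e (B.pathPoint u x l).2.1 (B.pathPoint u x l).2.2
      rw [hl.1, ← B.pathPoint_fst u x l] at h
      exact h
  refine LinearIndependent.of_comp f ?_
  have hcomp : (f ∘ fun l : {l : List E // IsPathTo G u l} => pathElt K G u l.1) =
      (fun b : V × (ℕ ⊕ E) × ℤ => (Pi.single b 1 : V × (ℕ ⊕ E) × ℤ → K)) ∘
        fun l : {l : List E // IsPathTo G u l} => B.pathPoint u x l.1 := by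
    funext l
    exact hf l.1 l.2
  rw [hcomp]
  refine (Pi.linearIndependent_single_one _ K).comp _ ?_
  rintro ⟨l, hl⟩ ⟨m, hm⟩ hlm
  have hlm' : B.pathPoint u x l = B.pathPoint u x m := hlm
  refine Subtype.ext (B.pathPoint_injective u x (by rw [hlm']) (by rw [hlm']) ?_ hl hm)
  have h := congrArg (fun b => b.2.2) hlm'
  simp only [B.pathPoint_snd_snd] at h
  exact_mod_cast h

theorem vert_ne_zero (u : V) : vert K G u ≠ 0 :=
  (linearIndependent_pathElt K (G := G) u).ne_zero (⟨[], trivial⟩ : {l : List E // IsPathTo G u l})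

end Paths

end LeavittPathAlgebra

namespace LeavittPathAlgebra

/-! ### Prefixes of powers of words. -/

section Words

variable {α : Type*}

/-- Iterating the hypothesis makes `l` a prefix of `mⁿ l` for every `n`. For `n = |l|` the power
`mⁿ` alone is at least as long as `l`, since `m` is nonempty. -/
theorem prefix_flatten_replicate {l m : List α} (h : l <+: m ++ l) (hm : m ≠ []) :
    l <+: (List.replicate l.length m).flatten := by
  have key : ∀ n, l <+: (List.replicate n m).flatten ++ l := by
    intro n
    induction n with
    | zero => simp
    | succ n ih =>
      rw [List.replicate_succ, List.flatten_cons, List.append_assoc]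
      exact h.trans ((List.prefix_append_right_inj m).mpr ih)
  refine List.prefix_of_prefix_length_le (key l.length) (List.prefix_append _ _) ?_
  have := List.length_pos_iff.mpr hm
  simpa using Nat.le_mul_of_pos_right l.length this

theorem flatten_replicate_prefix (m : List α) {i j : ℕ} (hij : i ≤ j) :
    (List.replicate i m).flatten <+: (List.replicate j m).flatten := by
  obtain ⟨d, rfl⟩ := Nat.exists_eq_add_of_le hij
  rw [List.replicate_add, List.flatten_append]
  exact List.prefix_append _ _

/-- If every word `BⁱA` is a prefix of a power of one of finitely many words, then one of `A` and
`B` is a prefix of the other. -/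
theorem prefix_or_prefix_of_powers (M : Finset (List α)) (A B : List α)
    (h : ∀ i, ∃ m ∈ M, ∃ n, (List.replicate i B).flatten ++ A <+: (List.replicate n m).flatten) :
    A <+: B ∨ B <+: A := by
  choose f hf n hn using h
  -- By the pigeonhole principle two exponents `i < j` share the same word of `M`. Then `BⁱA` and
  -- `BʲA` are prefixes of a common power, hence comparable. Cancelling `Bⁱ` compares `A` with a
  -- word that begins with `B`.
  obtain ⟨i, j, hij, hfij⟩ := Finite.exists_ne_map_eq_of_infinite fun i => (⟨f i, hf i⟩ : M)
  wlog hlt : i < j generalizing i j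
  · exact this j i hij.symm hfij.symm (lt_of_le_of_ne (not_lt.mp hlt) hij.symm)
  have hfij' : f i = f j := congrArg Subtype.val hfij
  obtain ⟨d, rfl⟩ := Nat.exists_eq_add_of_lt hlt
  have h1 := (hn i).trans (flatten_replicate_prefix (f i) (le_max_left (n i) (n (i + d + 1))))
  have h2 := (hn (i + d + 1)).trans
    (flatten_replicate_prefix _ (le_max_right (n i) (n (i + d + 1))))
  rw [← hfij'] at h2
  have hB : (List.replicate (i + d + 1) B).flatten ++ A =
      (List.replicate i B).flatten ++ (B ++ ((List.replicate d B).flatten ++ A)) := by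
    rw [add_assoc, List.replicate_add, List.flatten_append, List.replicate_succ,
      List.flatten_cons]
    simp
  rw [hB] at h2
  rcases List.prefix_or_prefix_of_prefix h1 h2 with h3 | h3
  · exact List.prefix_or_prefix_of_prefix ((List.prefix_append_right_inj _).mp h3)
      (List.prefix_append _ _)
  · exact Or.inr ((List.prefix_append _ _).trans ((List.prefix_append_right_inj _).mp h3))

end Words

/-! ### Reduction of a nonzero element to closed paths. -/

section Reduction

variable (K : Type uK) [Field K] {V : Type uV} {E : Type uE} (G : DirectedGraph V E)

/-- The linear combinations of paths that end in `u`. -/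
noncomputable def pathSpan (u : V) : Submodule K (LeavittPathAlgebra K G) :=
  Submodule.span K (Set.range (pathElt K G u))

variable {G}

theorem exists_linearCombination_of_mem_pathSpan {u : V} {a : LeavittPathAlgebra K G}
    (ha : a ∈ pathSpan K G u) : ∃ c : {l : List E // IsPathTo G u l} →₀ K,
      Finsupp.linearCombination K
        (fun l : {l : List E // IsPathTo G u l} => pathElt K G u l.1) c = a := by
  rw [← LinearMap.mem_range, Finsupp.range_linearCombination]
  refine Submodule.span_le.mpr ?_ ha
  rintro _ ⟨l, rfl⟩
  by_cases hl : IsPathTo G u l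
  · exact Submodule.subset_span ⟨⟨l, hl⟩, rfl⟩
  · rw [pathElt_eq_zero K hl]; exact Submodule.zero_mem _

/-- Right multiplication by an edge is injective on the combinations of paths that end in its
source. -/
theorem eq_zero_of_mul_edge_eq_zero {e : E} {a : LeavittPathAlgebra K G}
    (ha : a ∈ pathSpan K G (G.s e)) (h : a * edge K G e = 0) : a = 0 := by
  obtain ⟨c, rfl⟩ := exists_linearCombination_of_mem_pathSpan K ha
  -- Appending `e` is injective on paths, so linear independence is preserved.
  let f : {l : List E // IsPathTo G (G.s e) l} → {l : List E // IsPathTo G (G.r e) l} :=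
    fun l => ⟨l.1 ++ [e], isPathTo_append.mpr ⟨l.2, rfl, trivial⟩⟩
  have hf : Function.Injective f := fun l m hlm =>
    Subtype.ext (List.append_cancel_right (congrArg Subtype.val hlm))
  have hli := (linearIndependent_pathElt K (G := G) (G.r e)).comp f hf
  have hc : Finsupp.linearCombination K
      ((fun l : {l : List E // IsPathTo G (G.r e) l} => pathElt K G (G.r e) l.1) ∘ f) c = 0 := by
    rw [← h, Finsupp.linearCombination_apply, Finsupp.linearCombination_apply, Finsupp.sum,
      Finsupp.sum, Finset.sum_mul]
    refine Finset.sum_congr rfl fun l _ => ?_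
    rw [smul_mul_assoc, Function.comp_apply, pathElt_append]
    simp only [pathElt, pathSource, edge_mul_vert_range]
  rw [linearIndependent_iff.mp hli c hc, map_zero]

/-- Finite sums of vertices are local units. The auxiliary claim speaks of all larger sets `T'`, so
that the sets of two summands can be united. -/
theorem exists_mul_vert_ne_zero {x : LeavittPathAlgebra K G} (hx : x ≠ 0) :
    ∃ u, x * vert K G u ≠ 0 := by
  classical
  by_contra! h
  have key : ∀ x : LeavittPathAlgebra K G, ∃ T : Finset V, ∀ T', T ⊆ T' →
      ∑ u ∈ T', x * vert K G u = x := by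
    intro x
    have hx : x ∈ (⊤ : Submodule K (LeavittPathAlgebra K G)) := trivial
    rw [← span_pathElt_mul_ghostElt] at hx
    induction hx using Submodule.span_induction with
    | mem x hx =>
      obtain ⟨⟨t, l, m⟩, rfl⟩ := hx
      refine ⟨{pathSource G t m}, fun T' hT' => ?_⟩
      dsimp only
      rw [Finset.sum_eq_single (pathSource G t m), mul_assoc, ghostElt_mul_vert]
      · intro v _ hv
        rw [mul_assoc, ghostElt_mul_vert_of_ne K hv.symm, mul_zero]
      · intro hnot
        exact absurd (hT' (Finset.mem_singleton_self _)) hnot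
    | zero => exact ⟨∅, fun T' _ => by simp⟩
    | add x y _ _ hx hy =>
      obtain ⟨T₁, h₁⟩ := hx
      obtain ⟨T₂, h₂⟩ := hy
      refine ⟨T₁ ∪ T₂, fun T' hT' => ?_⟩
      simp only [add_mul, Finset.sum_add_distrib]
      rw [h₁ T' (Finset.union_subset_left hT'), h₂ T' (Finset.union_subset_right hT')]
    | smul k x _ hx =>
      obtain ⟨T, h⟩ := hx
      refine ⟨T, fun T' hT' => ?_⟩
      simp only [smul_mul_assoc, ← Finset.smul_sum]
      rw [h T' hT']
  obtain ⟨T, hT⟩ := key x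
  refine hx ?_
  rw [← hT T subset_rfl]
  exact Finset.sum_eq_zero fun u _ => h u

/-- Every element times a vertex is a combination of paths plus a combination of elements that
end in a ghost edge. -/
theorem exists_mul_vert_eq_add (u : V) (x : LeavittPathAlgebra K G) :
    ∃ a ∈ pathSpan K G u, ∃ y, ∃ J : Finset E, x * vert K G u = a + y ∧
      (∀ e ∈ J, G.s e = u) ∧ (∀ e ∉ J, y * edge K G e = 0) ∧
      ∑ e ∈ J, y * edge K G e * ghost K G e = y := by
  classical
  -- Allowing every `J' ⊇ J` makes the claim additive: the sets of two summands are united.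
  suffices H : ∃ a ∈ pathSpan K G u, ∃ y, ∃ J : Finset E, x * vert K G u = a + y ∧
      (∀ e ∈ J, G.s e = u) ∧ (∀ e ∉ J, y * edge K G e = 0) ∧
      ∀ J', J ⊆ J' → ∑ e ∈ J', y * edge K G e * ghost K G e = y by
    obtain ⟨a, ha, y, J, h1, h2, h3, h4⟩ := H
    exact ⟨a, ha, y, J, h1, h2, h3, h4 J subset_rfl⟩
  have hx : x ∈ (⊤ : Submodule K (LeavittPathAlgebra K G)) := trivial
  rw [← span_pathElt_mul_ghostElt] at hx
  induction hx using Submodule.span_induction with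
  | mem x hx =>
    obtain ⟨⟨t, l, m⟩, rfl⟩ := hx
    dsimp only
    by_cases hu : pathSource G t m = u
    · subst hu
      rw [mul_assoc, ghostElt_mul_vert]
      cases m with
      | nil =>
        refine ⟨pathElt K G t l, Submodule.subset_span ⟨l, rfl⟩, 0, ∅, ?_, by simp, by simp,
          by simp⟩
        simp [ghostElt, pathElt_mul_vert]
      | cons e m =>
        have hne : ∀ f, f ≠ e → pathElt K G t l * (ghostElt K G t (e :: m)) * edge K G f = 0 := by
          intro f hf
          simp only [ghostElt, mul_assoc, ghost_mul_edge_of_ne K G hf.symm, mul_zero]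
        refine ⟨0, Submodule.zero_mem _, _, {e}, (zero_add _).symm, ?_, ?_, ?_⟩
        · intro f hf
          rw [Finset.mem_singleton.mp hf]; rfl
        · intro f hf
          exact hne f (by simpa using hf)
        · intro J' hJ'
          rw [Finset.sum_eq_single e]
          · simp only [ghostElt, mul_assoc, ghost_mul_edge_self]
            rw [vert_range_mul_ghost]
          · intro f _ hf
            rw [hne f hf, zero_mul]
          · intro hnot
            exact absurd (hJ' (Finset.mem_singleton_self _)) hnot
    · refine ⟨0, Submodule.zero_mem _, 0, ∅, ?_, by simp, by simp, by simp⟩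
      rw [mul_assoc, ghostElt_mul_vert_of_ne K hu, mul_zero, add_zero]
  | zero => exact ⟨0, Submodule.zero_mem _, 0, ∅, by simp, by simp, by simp, by simp⟩
  | add x x' _ _ hx hx' =>
    obtain ⟨a, ha, y, J, h1, h2, h3, h4⟩ := hx
    obtain ⟨a', ha', y', J', h1', h2', h3', h4'⟩ := hx'
    refine ⟨a + a', Submodule.add_mem _ ha ha', y + y', J ∪ J', ?_, ?_, ?_, ?_⟩
    · rw [add_mul, h1, h1']; abel
    · intro e he
      rcases Finset.mem_union.mp he with he | he
      exacts [h2 e he, h2' e he]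
    · intro e he
      rw [Finset.mem_union, not_or] at he
      rw [add_mul, h3 e he.1, h3' e he.2, add_zero]
    · intro T hT
      simp only [add_mul, Finset.sum_add_distrib]
      rw [h4 T (Finset.union_subset_left hT), h4' T (Finset.union_subset_right hT)]
  | smul k x _ hx =>
    obtain ⟨a, ha, y, J, h1, h2, h3, h4⟩ := hx
    refine ⟨k • a, Submodule.smul_mem _ k ha, k • y, J, ?_, h2, ?_, ?_⟩
    · rw [smul_mul_assoc, h1, smul_add]
    · intro e he
      rw [smul_mul_assoc, h3 e he, smul_zero]
    · intro T hT
      simp only [smul_mul_assoc, ← Finset.smul_sum]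
      rw [h4 T hT]

/-- A nonzero element that is annihilated on the right by all edges with source `u` is a
combination of paths after multiplication by `u`. -/
theorem mul_vert_mem_pathSpan {u : V} {x : LeavittPathAlgebra K G} (hx : x * vert K G u ≠ 0)
    (h : ∀ e, G.s e = u → x * edge K G e = 0) : x * vert K G u ∈ pathSpan K G u := by
  obtain ⟨a, ha, y, J, hay, hJ, hyJ, hy⟩ := exists_mul_vert_eq_add K u x
  have hedge : ∀ e, G.s e = u → a * edge K G e + y * edge K G e = 0 := by
    intro e he
    rw [← add_mul, ← hay, mul_assoc, ← he, vert_source_mul_edge, h e he]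
  -- At a sink `y = 0`. If `u` emits finitely many edges, relation (4) gives `x u = 0`, a
  -- contradiction. The infinite emitter remains.
  rcases Set.eq_empty_or_nonempty {e : E | G.s e = u} with hemp | hne
  · have hJ0 : J = ∅ := Finset.eq_empty_of_forall_notMem fun e he =>
      (Set.eq_empty_iff_forall_notMem.mp hemp e) (hJ e he)
    rw [hJ0, Finset.sum_empty] at hy
    rw [hay, ← hy, add_zero]
    exact ha
  · by_cases hfin : {e : E | G.s e = u}.Finite
    · refine absurd ?_ hx
      rw [vert_eq_sum K G u hne hfin, Finset.mul_sum]
      refine Finset.sum_eq_zero fun e he => ?_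
      rw [← mul_assoc, h e (by simpa using he), zero_mul]
    · obtain ⟨e, he, heJ⟩ := Set.Infinite.exists_notMem_finset hfin J
      have he' : G.s e = u := he
      have ha0 : a = 0 := by
        refine eq_zero_of_mul_edge_eq_zero K (e := e) (he'.symm ▸ ha) ?_
        simpa [hyJ e heJ] using hedge e he'
      refine absurd ?_ hx
      rw [hay, ha0, zero_add, ← hy]
      refine Finset.sum_eq_zero fun f hf => ?_
      have := hedge f (hJ f hf)
      rw [ha0, zero_mul, zero_add] at this
      rw [this, zero_mul]

variable (G) in
/-- The combinations of monomials whose ghost part has length at most `n`. -/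
noncomputable def ghostFiltration (n : ℕ) : Submodule K (LeavittPathAlgebra K G) :=
  Submodule.span K ((fun y : V × List E × List E =>
    pathElt K G y.1 y.2.1 * ghostElt K G y.1 y.2.2) '' {y | y.2.2.length ≤ n})

theorem mul_mem_of_mem_ghostFiltration {n : ℕ} {S : Submodule K (LeavittPathAlgebra K G)}
    {b x : LeavittPathAlgebra K G} (hx : x ∈ ghostFiltration K G n)
    (h : ∀ t l m, m.length ≤ n → pathElt K G t l * ghostElt K G t m * b ∈ S) : x * b ∈ S := by
  induction hx using Submodule.span_induction with
  | mem x hx =>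
    obtain ⟨⟨t, l, m⟩, hm, rfl⟩ := hx
    exact h t l m hm
  | zero => rw [zero_mul]; exact S.zero_mem
  | add x y _ _ hx hy => rw [add_mul]; exact S.add_mem hx hy
  | smul k x _ hx => rw [smul_mul_assoc]; exact S.smul_mem k hx

theorem mul_vert_mem_pathSpan_of_mem {u : V} {x : LeavittPathAlgebra K G}
    (hx : x ∈ ghostFiltration K G 0) : x * vert K G u ∈ pathSpan K G u := by
  refine mul_mem_of_mem_ghostFiltration K hx fun t l m hm => ?_
  obtain rfl : m = [] := List.length_eq_zero_iff.mp (Nat.le_zero.mp hm)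
  rw [ghostElt, pathElt_mul_vert]
  by_cases ht : t = u
  · subst ht
    rw [pathElt_mul_vert]
    exact Submodule.subset_span ⟨l, rfl⟩
  · rw [pathElt_mul_vert_of_ne K ht]
    exact Submodule.zero_mem _

/-- The edge cancels the last ghost edge of a monomial or annihilates the monomial. Without ghost
part it only lengthens the path or gives zero. -/
theorem mul_edge_mem_ghostFiltration {n : ℕ} {e : E} {x : LeavittPathAlgebra K G}
    (hx : x ∈ ghostFiltration K G (n + 1)) : x * edge K G e ∈ ghostFiltration K G n := by
  have hmem : ∀ t l m, m.length ≤ n → pathElt K G t l * ghostElt K G t m ∈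
      ghostFiltration K G n := fun t l m hm => Submodule.subset_span ⟨(t, l, m), hm, rfl⟩
  refine mul_mem_of_mem_ghostFiltration K hx fun t l m hm => ?_
  cases m with
  | nil =>
    rw [ghostElt, pathElt_mul_vert]
    by_cases ht : t = G.s e
    · subst ht
      have h := hmem (G.r e) (l ++ [e]) [] (Nat.zero_le n)
      rw [ghostElt, pathElt_mul_vert, pathElt_append] at h
      simpa only [pathElt, pathSource, edge_mul_vert_range] using h
    · rw [← vert_source_mul_edge, ← mul_assoc, pathElt_mul_vert_of_ne K ht, zero_mul]
      exact Submodule.zero_mem _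
  | cons f m =>
    rw [ghostElt, mul_assoc, mul_assoc]
    by_cases hfe : f = e
    · subst hfe
      rw [ghost_mul_edge_self]
      by_cases hr : pathSource G t m = G.r f
      · rw [← hr, ghostElt_mul_vert]
        exact hmem t l m (by simpa using hm)
      · rw [ghostElt_mul_vert_of_ne K hr, mul_zero]
        exact Submodule.zero_mem _
    · rw [ghost_mul_edge_of_ne K G hfe, mul_zero, mul_zero]
      exact Submodule.zero_mem _

theorem exists_mem_ghostFiltration (x : LeavittPathAlgebra K G) :
    ∃ n, x ∈ ghostFiltration K G n := by
  have hmono : Monotone (ghostFiltration K G) := fun i j hij =>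
    Submodule.span_mono (Set.image_mono fun y (hy : _ ≤ i) => hy.trans hij)
  have hx : x ∈ (⊤ : Submodule K (LeavittPathAlgebra K G)) := trivial
  rw [← span_pathElt_mul_ghostElt] at hx
  induction hx using Submodule.span_induction with
  | mem x hx =>
    obtain ⟨⟨t, l, m⟩, rfl⟩ := hx
    exact ⟨m.length, Submodule.subset_span ⟨(t, l, m), le_refl m.length, rfl⟩⟩
  | zero => exact ⟨0, Submodule.zero_mem _⟩
  | add x y _ _ hx hy =>
    obtain ⟨i, hi⟩ := hx
    obtain ⟨j, hj⟩ := hy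
    exact ⟨max i j, Submodule.add_mem _ (hmono (le_max_left i j) hi)
      (hmono (le_max_right i j) hj)⟩
  | smul k x _ hx =>
    obtain ⟨i, hi⟩ := hx
    exact ⟨i, Submodule.smul_mem _ k hi⟩

/-- Every nonzero element has a nonzero right multiple that is a combination of paths with a
common end. -/
theorem exists_mul_mem_pathSpan {x : LeavittPathAlgebra K G} (hx : x ≠ 0) :
    ∃ b u, x * b ≠ 0 ∧ x * b ∈ pathSpan K G u := by
  obtain ⟨n, hn⟩ := exists_mem_ghostFiltration K x
  induction n generalizing x with
  | zero =>
    obtain ⟨u, hu⟩ := exists_mul_vert_ne_zero K hx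
    exact ⟨vert K G u, u, hu, mul_vert_mem_pathSpan_of_mem K hn⟩
  | succ n ih =>
    obtain ⟨u, hu⟩ := exists_mul_vert_ne_zero K hx
    -- Either `x u` is already a combination of paths, or some `x e ≠ 0` has a smaller ghost degree.
    by_cases h : ∀ e, G.s e = u → x * edge K G e = 0
    · exact ⟨vert K G u, u, hu, mul_vert_mem_pathSpan K hu h⟩
    · push Not at h
      obtain ⟨e, rfl, he⟩ := h
      obtain ⟨b, u, h1, h2⟩ := ih he (mul_edge_mem_ghostFiltration K hn)
      exact ⟨edge K G e * b, u, by rwa [← mul_assoc], by rwa [← mul_assoc]⟩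

variable (G) in
/-- A list of edges is a closed path at `u`. -/
def IsClosedAt (u : V) (l : List E) : Prop :=
  IsPathTo G u l ∧ pathSource G u l = u

/-- The end is the range of the last edge; the empty list is a path to every vertex. -/
theorem IsPathTo.end_unique {u t : V} {l : List E} (hl : l ≠ []) (hu : IsPathTo G u l)
    (ht : IsPathTo G t l) : u = t := by
  induction l with
  | nil => exact absurd rfl hl
  | cons e l ih =>
    by_cases h : l = []
    · subst h
      exact hu.1.symm.trans ht.1
    · exact ih h hu.2 ht.2

/-- Every nonzero element of `L_K(E)` can be multiplied to a combination of closed paths with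
nonzero constant coefficient. -/
theorem exists_mul_mul_eq {x : LeavittPathAlgebra K G} (hx : x ≠ 0) :
    ∃ a b u, ∃ k : K, k ≠ 0 ∧ ∃ c : List E →₀ K, (∀ m ∈ c.support, IsClosedAt G u m ∧ m ≠ []) ∧
      a * x * b = k • vert K G u + Finsupp.linearCombination K (pathElt K G u) c := by
  classical
  obtain ⟨b, u, hb, hmem⟩ := exists_mul_mem_pathSpan K hx
  obtain ⟨c, hc⟩ := exists_linearCombination_of_mem_pathSpan K hmem
  have hc0 : c.support.Nonempty := by
    rw [Finsupp.support_nonempty_iff]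
    rintro rfl
    rw [map_zero] at hc
    exact hb hc.symm
  -- For a shortest path `l` in the support, left multiplication by `l*` turns `l` into `u`. Any
  -- other path loses the prefix `l` or is annihilated, and minimality ensures that no ghost edges
  -- are left over.
  obtain ⟨l, hl, hmin⟩ := c.support.exists_min_image (fun l => l.1.length) hc0
  set S : Set (List E) := {m | IsClosedAt G u m ∧ m ≠ []} with hS
  have hterm : ∀ m ∈ c.support, m ≠ l → ghostElt K G u l.1 * pathElt K G u m.1 ∈
      Submodule.span K (pathElt K G u '' S) := by
    intro m hm hml
    by_cases hpre : l.1 <+: m.1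
    · obtain ⟨d, hd⟩ := hpre
      have hd0 : d ≠ [] := by
        rintro rfl
        exact hml (Subtype.ext (by rw [← hd, List.append_nil]))
      have hm' := m.2
      rw [← hd, isPathTo_append] at hm'
      rw [← hd, pathElt_append, ← mul_assoc]
      by_cases hdu : pathSource G u d = u
      · rw [hdu, ghostElt_mul_pathElt_self K l.2]
        have h := vert_mul_pathElt K (G := G) u d
        rw [hdu] at h
        exact Submodule.subset_span ⟨d, ⟨⟨hm'.2, hdu⟩, hd0⟩, h.symm⟩
      -- The remainder `d` can start elsewhere than in `u` only if `l` is empty, and then `u d = 0`.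
      · have hl0 : l.1 = [] := by
          by_contra hl0
          exact hdu (hm'.1.end_unique hl0 l.2)
        rw [hl0]
        simp only [ghostElt, pathElt]
        rw [vert_mul_vert_of_ne K G (Ne.symm hdu), zero_mul]
        exact Submodule.zero_mem _
    · rw [ghostElt_mul_pathElt_of_not_prefix K (hmin m hm) hpre]
      exact Submodule.zero_mem _
  have hsum : ∑ m ∈ c.support.erase l, c m • (ghostElt K G u l.1 * pathElt K G u m.1) ∈
      Submodule.span K (pathElt K G u '' S) :=
    Submodule.sum_mem _ fun m hm => Submodule.smul_mem _ _
      (hterm m (Finset.mem_of_mem_erase hm) (Finset.ne_of_mem_erase hm))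
  obtain ⟨d, hd, hd'⟩ := (Finsupp.mem_span_image_iff_linearCombination K).mp hsum
  refine ⟨ghostElt K G u l.1, b, u, c l, Finsupp.mem_support_iff.mp hl, d,
    fun m hm => hd hm, ?_⟩
  rw [hd', mul_assoc, ← hc, Finsupp.linearCombination_apply, Finsupp.sum, Finset.mul_sum,
    ← Finset.add_sum_erase _ _ hl, mul_smul_comm, ghostElt_mul_pathElt_self K l.2]
  congr 1
  exact Finset.sum_congr rfl fun m _ => mul_smul_comm _ _ _

end Reduction
end LeavittPathAlgebra

namespace LeavittPathAlgebra

/-! ### Closed paths at a vertex. -/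

section ClosedPaths

variable {V : Type uV} {E : Type uE} {G : DirectedGraph V E}

theorem IsClosedAt.append {u : V} {l m : List E} (hl : IsClosedAt G u l) (hm : IsClosedAt G u m) :
    IsClosedAt G u (l ++ m) := by
  refine ⟨isPathTo_append.mpr ⟨?_, hm.1⟩, ?_⟩
  · rw [hm.2]; exact hl.1
  · rw [pathSource_append, hm.2, hl.2]

theorem IsClosedAt.of_append {u : V} {l m : List E} (hl : IsClosedAt G u l) (hl0 : l ≠ [])
    (hlm : IsClosedAt G u (l ++ m)) : IsClosedAt G u m := by
  have h := isPathTo_append.mp hlm.1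
  exact ⟨h.2, h.1.end_unique hl0 hl.1⟩

theorem IsClosedAt.flatten_replicate {u : V} {m : List E} (hm : IsClosedAt G u m) (n : ℕ) :
    IsClosedAt G u (List.replicate n m).flatten := by
  induction n with
  | zero => exact ⟨trivial, rfl⟩
  | succ n ih =>
    rw [List.replicate_succ, List.flatten_cons]
    exact hm.append ih

/-- If every path that starts in `u` is a prefix of a power of one of finitely many closed paths,
then any two paths that start in `u` are comparable. -/
theorem prefix_or_prefix_of_isPathTo {u : V} (M : Finset (List E))
    (hM : ∀ m ∈ M, IsClosedAt G u m)
    (h : ∀ t l, IsPathTo G t l → pathSource G t l = u →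
      ∃ m ∈ M, ∃ n, l <+: (List.replicate n m).flatten)
    {t t' : V} {l l' : List E} (hl : IsPathTo G t l) (hlu : pathSource G t l = u)
    (hl' : IsPathTo G t' l') (hlu' : pathSource G t' l' = u) : l <+: l' ∨ l' <+: l := by
  obtain ⟨m, hm, n, hn⟩ := h t l hl hlu
  obtain ⟨m', hm', n', hn'⟩ := h t' l' hl' hlu'
  -- Unlike `l` and `l'`, the powers that extend them are closed at `u` and can be concatenated.
  -- Their comparability passes to the prefixes.
  have hA := (hM m hm).flatten_replicate n
  have hB := (hM m' hm').flatten_replicate n'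
  rcases prefix_or_prefix_of_powers M _ _ fun i => h u _
      ((hB.flatten_replicate i).append hA).1 ((hB.flatten_replicate i).append hA).2 with h1 | h1
  · exact List.prefix_or_prefix_of_prefix (hn.trans h1) hn'
  · exact List.prefix_or_prefix_of_prefix hn (hn'.trans h1)

/-- If any two paths that start in `u` are comparable, all closed paths at `u` are powers of a
single one. -/
theorem exists_closed_generator {u : V}
    (hcomp : ∀ l l', IsClosedAt G u l → IsClosedAt G u l' → l <+: l' ∨ l' <+: l)
    (hne : ∃ m, IsClosedAt G u m ∧ m ≠ []) :
    ∃ c, IsClosedAt G u c ∧ c ≠ [] ∧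
      ∀ m, IsClosedAt G u m → ∃ n, m = (List.replicate n c).flatten := by
  classical
  -- A shortest nonempty closed path is a prefix of every other one; cancelling it leaves a shorter
  -- closed path.
  have hex : ∃ n, ∃ m, IsClosedAt G u m ∧ m ≠ [] ∧ m.length = n := by
    obtain ⟨m, hm, hm0⟩ := hne
    exact ⟨_, m, hm, hm0, rfl⟩
  obtain ⟨c, hc, hc0, hlen⟩ := Nat.find_spec hex
  have hmin : ∀ m, IsClosedAt G u m → m ≠ [] → c.length ≤ m.length := fun m hm hm0 => by
    rw [hlen]
    exact Nat.find_min' hex ⟨m, hm, hm0, rfl⟩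
  refine ⟨c, hc, hc0, fun m hm => ?_⟩
  induction hk : m.length using Nat.strong_induction_on generalizing m with
  | _ k ih =>
    by_cases hm0 : m = []
    · exact ⟨0, by simp [hm0]⟩
    · have hcm : c <+: m := by
        rcases hcomp c m hc hm with h | h
        · exact h
        · rw [h.eq_of_length (le_antisymm h.length_le (hmin m hm hm0))]
      obtain ⟨d, rfl⟩ := hcm
      have hclt : 0 < c.length := List.length_pos_iff.mpr hc0
      obtain ⟨n, hn⟩ := ih d.length (by rw [← hk, List.length_append]; omega) d
        (hc.of_append hc0 hm) rfl
      exact ⟨n + 1, by rw [List.replicate_succ, List.flatten_cons, ← hn]⟩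

end ClosedPaths

/-! ### Cycles without exits, and injectivity of surjective endomorphisms. -/

section Corner

variable (K : Type uK) [Field K] {V : Type uV} {E : Type uE} {G : DirectedGraph V E}

/-- A path without exits is a partial isometry with range projection its source. -/
theorem pathElt_mul_ghostElt_of_no_exit {u : V} {l : List E} (hl : IsPathTo G u l)
    (h : ∀ f ∈ l, ∀ g, G.s g = G.s f → g = f) :
    pathElt K G u l * ghostElt K G u l = vert K G (pathSource G u l) := by
  induction l with
  | nil => exact vert_mul_vert_self K G u
  | cons e l ih =>
    -- Without an exit, relation (4) at `s(e)` reads `s(e) = e e*`.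
    have hset : {g : E | G.s g = G.s e} = {e} :=
      Set.eq_singleton_iff_unique_mem.mpr ⟨rfl, h e List.mem_cons_self⟩
    have hfin : {g : E | G.s g = G.s e}.Finite := by rw [hset]; exact Set.finite_singleton e
    have hto : hfin.toFinset = {e} := by ext g; simp [hset]
    rw [pathElt, ghostElt, mul_assoc, ← mul_assoc (pathElt K G u l),
      ih hl.2 fun f hf => h f (List.mem_cons_of_mem _ hf), ← hl.1, vert_range_mul_ghost,
      pathSource, vert_eq_sum K G (G.s e) ⟨e, rfl⟩ hfin, hto, Finset.sum_singleton]

/-- If every path that starts in `u` is a prefix of a closed path at `u` and any two paths that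
start in `u` are comparable, the corner at `u` is spanned by products of closed paths and closed
ghost paths. -/
theorem vert_mul_mul_vert_mem_span {u : V}
    (hext : ∀ t l, IsPathTo G t l → pathSource G t l = u → ∃ m, IsClosedAt G u m ∧ l <+: m)
    (hcomp : ∀ t t' l l', IsPathTo G t l → pathSource G t l = u → IsPathTo G t' l' →
      pathSource G t' l' = u → l <+: l' ∨ l' <+: l) (x : LeavittPathAlgebra K G) :
    vert K G u * x * vert K G u ∈ Submodule.span K
      {y | ∃ l m, IsClosedAt G u l ∧ IsClosedAt G u m ∧
        y = pathElt K G u l * ghostElt K G u m} := by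
  have hx : x ∈ (⊤ : Submodule K (LeavittPathAlgebra K G)) := trivial
  rw [← span_pathElt_mul_ghostElt] at hx
  induction hx using Submodule.span_induction with
  | mem x hx =>
    obtain ⟨⟨t, l, m⟩, rfl⟩ := hx
    dsimp only
    by_cases hlm : (IsPathTo G t l ∧ pathSource G t l = u) ∧ IsPathTo G t m ∧ pathSource G t m = u
    · obtain ⟨⟨hl, hlu⟩, hm, hmu⟩ := hlm
      -- The path `d` leads from `t` back to `u`. It has no exits, so `d d* = t` and `l m* = (l d)(m
      -- d)*` with closed paths `l d` and `m d`.
      have hd : ∃ d, IsClosedAt G u (m ++ d) ∧ pathSource G u d = t := by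
        by_cases hm0 : m = []
        · subst hm0
          exact ⟨[], ⟨trivial, rfl⟩, hmu.symm⟩
        · obtain ⟨_, hc, d, rfl⟩ := hext t m hm hmu
          exact ⟨d, hc, (isPathTo_append.mp hc.1).1.end_unique hm0 hm⟩
      obtain ⟨d, hc, hdt⟩ := hd
      have hdu := (isPathTo_append.mp hc.1).2
      -- Replacing `f` by an exit `g` would give two incomparable paths of the same length from `u`.
      have hexit : ∀ f ∈ d, ∀ g, G.s g = G.s f → g = f := by
        intro f hf g hg
        obtain ⟨a, b, rfl⟩ := List.append_of_mem hf
        have h1 : IsPathTo G (pathSource G u b) (m ++ a ++ [f]) ∧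
            pathSource G (pathSource G u b) (m ++ a ++ [f]) = u := by
          rw [← pathSource_append]
          have h2 := hc
          rw [show m ++ (a ++ f :: b) = m ++ a ++ [f] ++ b by simp] at h2
          exact ⟨(isPathTo_append.mp h2.1).1, h2.2⟩
        have h2 : IsPathTo G (G.r g) (m ++ a ++ [g]) ∧
            pathSource G (G.r g) (m ++ a ++ [g]) = u := by
          rw [pathSource_append, isPathTo_append] at h1 ⊢
          simp only [pathSource, IsPathTo] at h1 ⊢
          rw [hg]
          exact ⟨⟨h1.1.1, by simp⟩, h1.2⟩
        have h3 : m ++ a ++ [g] = m ++ a ++ [f] := by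
          rcases hcomp _ _ _ _ h1.1 h1.2 h2.1 h2.2 with h | h
          · exact (h.eq_of_length (by simp)).symm
          · exact h.eq_of_length (by simp)
        simpa using h3
      have hkey : vert K G u * (pathElt K G t l * ghostElt K G t m) * vert K G u =
          pathElt K G u (l ++ d) * ghostElt K G u (m ++ d) := by
        rw [pathElt_append, ghostElt_append, hdt, mul_assoc (pathElt K G t l),
          ← mul_assoc (pathElt K G u d), pathElt_mul_ghostElt_of_no_exit K hdu hexit, hdt,
          vert_mul_ghostElt, ← mul_assoc, mul_assoc, ← hlu, vert_mul_pathElt, hlu, ← hmu,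
          ghostElt_mul_vert]
      rw [hkey]
      refine Submodule.subset_span ⟨_, _, ⟨isPathTo_append.mpr ⟨hdt ▸ hl, hdu⟩, ?_⟩, hc, rfl⟩
      rw [pathSource_append, hdt, hlu]
    · have h0 : vert K G u * (pathElt K G t l * ghostElt K G t m) * vert K G u = 0 := by
        rw [not_and_or, not_and_or, not_and_or] at hlm
        rcases hlm with (h | h) | (h | h)
        · rw [pathElt_eq_zero K h, zero_mul, mul_zero, zero_mul]
        · rw [← mul_assoc, vert_mul_pathElt_of_ne K (Ne.symm h), zero_mul, zero_mul]
        · rw [ghostElt_eq_zero K h, mul_zero, mul_zero, zero_mul]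
        · rw [mul_assoc, mul_assoc, ghostElt_mul_vert_of_ne K h, mul_zero, mul_zero]
      rw [h0]
      exact Submodule.zero_mem _
  | zero => rw [mul_zero, zero_mul]; exact Submodule.zero_mem _
  | add x y _ _ hx hy => rw [mul_add, add_mul]; exact Submodule.add_mem _ hx hy
  | smul k x _ hx => rw [mul_smul_comm, smul_mul_assoc]; exact Submodule.smul_mem _ k hx

open Polynomial in
/-- A surjective endomorphism that fixes the vertices does not annihilate a polynomial with
nonzero constant term in the generator of a corner of Laurent polynomials. -/
theorem map_ne_zero_of_cycle {φ : LeavittPathAlgebra K G →ₙₐ[K] LeavittPathAlgebra K G}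
    (hφ : Function.Surjective φ) (hvert : ∀ u, φ (vert K G u) = vert K G u) {u : V} {c : List E}
    (hc : IsClosedAt G u c) (hc0 : c ≠ [])
    (hspan : ∀ x : LeavittPathAlgebra K G, vert K G u * x * vert K G u ∈ Submodule.span K
      {y | ∃ i j : ℕ, y = pathElt K G u (List.replicate i c).flatten *
        ghostElt K G u (List.replicate j c).flatten})
    {k : K} (hk : k ≠ 0) {y : LeavittPathAlgebra K G}
    (hy : y ∈ Submodule.span K (Set.range fun n : ℕ =>
      pathElt K G u (List.replicate (n + 1) c).flatten)) :
    φ (k • vert K G u + y) ≠ 0 := by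
  intro hzero
  let p : ℕ → LeavittPathAlgebra K G := fun i => pathElt K G u (List.replicate i c).flatten
  have hp_add : ∀ i j, p (i + j) = p i * p j := fun i j => by
    simp only [p]
    rw [List.replicate_add, List.flatten_append, pathElt_append, (hc.flatten_replicate j).2]
  have hp_zero : p 0 = vert K G u := rfl
  -- Substitution of `c` for `X`, with `u` in the role of `1`.
  let g : K[X] →ₗ[K] LeavittPathAlgebra K G := (Polynomial.basisMonomials K).constr K p
  have hg_monomial : ∀ i, g (X ^ i) = p i := fun i => by
    rw [X_pow_eq_monomial]
    simpa using (Polynomial.basisMonomials K).constr_basis K p i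
  have hg_mul : ∀ a b, g (a * b) = g a * g b := by
    intro a b
    induction a using Polynomial.induction_on' with
    | add a a' ha ha' => rw [add_mul, map_add, map_add, add_mul, ha, ha']
    | monomial i r =>
      induction b using Polynomial.induction_on' with
      | add b b' hb hb' => rw [mul_add, map_add, map_add, mul_add, hb, hb']
      | monomial j s =>
        rw [← C_mul_X_pow_eq_monomial, ← C_mul_X_pow_eq_monomial, ← smul_eq_C_mul,
          ← smul_eq_C_mul, smul_mul_smul_comm, ← pow_add, map_smul, map_smul, map_smul,
          hg_monomial, hg_monomial, hg_monomial, hp_add, smul_mul_smul_comm]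
  have hp_inj : Function.Injective fun i => (List.replicate i c).flatten := fun i j hij => by
    have h := congrArg List.length hij
    simpa [hc0] using h
  have hg_inj : Function.Injective g := by
    refine Module.Basis.injective_constr_of_linearIndependent _ ?_
    exact (linearIndependent_pathElt K (G := G) u).comp
      (fun i : ℕ => (⟨_, (hc.flatten_replicate i).1⟩ : {l : List E // IsPathTo G u l}))
      fun i j hij => hp_inj (congrArg Subtype.val hij)
  obtain ⟨f, hf⟩ : ∃ f : K[X], g (X * f) = y := by
    clear hzero
    induction hy using Submodule.span_induction with
    | mem y hy =>
      obtain ⟨n, rfl⟩ := hy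
      exact ⟨X ^ n, by rw [← pow_succ', hg_monomial]⟩
    | zero => exact ⟨0, by simp⟩
    | add a b _ _ ha hb =>
      obtain ⟨f, rfl⟩ := ha
      obtain ⟨f', rfl⟩ := hb
      exact ⟨f + f', by rw [mul_add, map_add]⟩
    | smul r a _ ha =>
      obtain ⟨f, rfl⟩ := ha
      exact ⟨r • f, by rw [mul_smul_comm, map_smul]⟩
  let h : K[X] →ₗ[K] LeavittPathAlgebra K G := (φ : _ →ₗ[K] _) ∘ₗ g
  have hh : ∀ a, h a = φ (g a) := fun _ => rfl
  have hh_mul : ∀ a b, h (a * b) = h a * h b := fun a b => by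
    rw [hh, hg_mul, map_mul, hh, hh]
  have hg_one : g 1 = vert K G u := by rw [← pow_zero X, hg_monomial, hp_zero]
  have hh_one : h 1 = vert K G u := by rw [hh, hg_one, hvert]
  set q : K[X] := C k + X * f with hq
  have hgq : g q = k • vert K G u + y := by
    rw [hq, map_add, hf, ← mul_one (C k), ← smul_eq_C_mul, map_smul, hg_one]
  have hhq : h q = 0 := by rw [hh, hgq, hzero]
  have hq0 : q ≠ 0 := by
    intro h0
    have := congrArg (fun a => Polynomial.coeff a 0) h0
    simp [hq] at this
    exact hk this
  -- Since `h q = 0`, the value `h a` depends only on the remainder of `a` modulo `q`.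
  have hfin : Module.Finite K (LinearMap.range h) := by
    have hle : LinearMap.range h ≤ (degreeLT K q.natDegree).map h := by
      rintro _ ⟨a, rfl⟩
      refine ⟨a % q, ?_, ?_⟩
      · rw [SetLike.mem_coe, mem_degreeLT, ← degree_eq_natDegree hq0]
        exact degree_mod_lt a hq0
      · conv_rhs => rw [← EuclideanDomain.mod_add_div a q]
        rw [map_add, hh_mul, hhq, zero_mul, add_zero]
    rw [le_antisymm hle (Submodule.map_le_iff_le_comap.mpr fun a _ => ⟨a, rfl⟩)]
    infer_instance
  let p' : ℕ → LeavittPathAlgebra K G := fun i => ghostElt K G u (List.replicate i c).flatten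
  have hp'_succ : ∀ i, p' (i + 1) = p' i * p' 1 := fun i => by
    have h1 : (List.replicate (i + 1) c).flatten =
        (List.replicate 1 c).flatten ++ (List.replicate i c).flatten := by
      rw [← List.flatten_append, ← List.replicate_add, add_comm]
    simp only [p']
    rw [h1, ghostElt_append, (hc.flatten_replicate i).2]
  have hp'_vert : p' 1 * vert K G u = p' 1 := by
    have := ghostElt_mul_vert K (G := G) u (List.replicate 1 c).flatten
    rwa [(hc.flatten_replicate 1).2] at this
  have hp'_p : p' 1 * p 1 = vert K G u :=
    ghostElt_mul_pathElt_self K (hc.flatten_replicate 1).1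
  have hp'_range : ∀ i, ∃ a, h a = φ (p' i) := by
    -- Multiplying `0 = h q = k u + φ(c) h(f)` by `φ(c*)` on the left gives `k φ(c*) + h(f) = 0`,
    -- and `k` is invertible.
    have h1 : φ (p' 1) = h (-(k⁻¹ • f)) := by
      have h2 : φ (p' 1) * h q = 0 := by rw [hhq, mul_zero]
      rw [hq, ← mul_one (C k), ← smul_eq_C_mul, map_add, map_smul, hh_one, hh_mul, mul_add,
        mul_smul_comm, ← hvert u, ← map_mul, hp'_vert, ← mul_assoc, hh X, ← map_mul,
        ← pow_one X, hg_monomial, hp'_p, hvert, ← hh_one, ← hh_mul, one_mul] at h2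
      rw [map_neg, map_smul, eq_neg_iff_add_eq_zero, ← smul_right_injective _ hk |>.eq_iff]
      simp only [smul_add, smul_zero, smul_smul, mul_inv_cancel₀ hk, one_smul]
      exact h2
    intro i
    induction i with
    | zero => exact ⟨1, by rw [hh_one, ← hvert u]; rfl⟩
    | succ i ih =>
      obtain ⟨a, ha⟩ := ih
      exact ⟨a * -(k⁻¹ • f), by rw [hh_mul, ha, ← h1, ← map_mul, ← hp'_succ]⟩
  have hcorner : ∀ x ∈ Submodule.span K
      {y | ∃ i j : ℕ, y = pathElt K G u (List.replicate i c).flatten *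
        ghostElt K G u (List.replicate j c).flatten}, φ x ∈ LinearMap.range h := by
    intro x hx
    induction hx using Submodule.span_induction with
    | mem x hx =>
      obtain ⟨i, j, rfl⟩ := hx
      obtain ⟨a, ha⟩ := hp'_range j
      refine ⟨X ^ i * a, ?_⟩
      rw [hh_mul, ha, hh, hg_monomial, ← map_mul]
    | zero => rw [map_zero]; exact Submodule.zero_mem _
    | add x y _ _ hx hy => rw [map_add]; exact Submodule.add_mem _ hx hy
    | smul r x _ hx => rw [map_smul]; exact Submodule.smul_mem _ r hx
  -- A preimage `x` of `g a` may be replaced by `u x u`, because `φ` fixes `u`. Thus `K[X]` embeds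
  -- into a finite-dimensional space.
  have hg_range : ∀ a, g a ∈ LinearMap.range h := by
    intro a
    obtain ⟨x, hx⟩ := hφ (g a)
    have h1 : φ (vert K G u * x * vert K G u) = g a := by
      rw [map_mul, map_mul, hx, hvert, ← hg_one, ← hg_mul, ← hg_mul, one_mul, mul_one]
    rw [← h1]
    exact hcorner _ (hspan x)
  exact Polynomial.not_finite (R := K) (Module.Finite.of_injective (g.codRestrict _ hg_range)
    fun a b hab => hg_inj (congrArg Subtype.val hab))

/-- A surjective endomorphism of a Leavitt path algebra that fixes the vertices is injective. -/
theorem injective_of_surjective {φ : LeavittPathAlgebra K G →ₙₐ[K] LeavittPathAlgebra K G}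
    (hφ : Function.Surjective φ) (hvert : ∀ u, φ (vert K G u) = vert K G u) :
    Function.Injective φ := by
  rw [injective_iff_map_eq_zero]
  intro x hx
  by_contra hx0
  obtain ⟨a, b, u, k, hk, c, hc, hab⟩ := exists_mul_mul_eq K hx0
  have hy : φ (k • vert K G u + Finsupp.linearCombination K (pathElt K G u) c) = 0 := by
    rw [← hab, map_mul, map_mul, hx, mul_zero, zero_mul]
  -- Otherwise `l* m l = 0` for all `m` in the support, and the kernel contains `k t`, although `φ`
  -- fixes `t ≠ 0`.
  have hprefix : ∀ t l, IsPathTo G t l → pathSource G t l = u →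
      ∃ m ∈ c.support, l <+: m ++ l := by
    intro t l hl hlu
    by_contra! hno
    have h0 : ghostElt K G t l *
        (k • vert K G u + Finsupp.linearCombination K (pathElt K G u) c) * pathElt K G t l =
        k • vert K G t := by
      rw [mul_add, add_mul, mul_smul_comm, smul_mul_assoc, ← hlu, ghostElt_mul_vert,
        ghostElt_mul_pathElt_self K hl, Finsupp.linearCombination_apply, Finsupp.sum,
        Finset.mul_sum, Finset.sum_mul, Finset.sum_eq_zero, add_zero]
      intro m hm
      rw [mul_smul_comm, smul_mul_assoc, mul_assoc, ← pathElt_append,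
        ghostElt_mul_pathElt_of_not_prefix K (by simp) (hno m hm), smul_zero]
    have h1 := congrArg φ h0
    rw [map_mul, map_mul, hy, mul_zero, zero_mul, map_smul, hvert] at h1
    exact smul_ne_zero hk (vert_ne_zero K t) h1.symm
  have hpower : ∀ t l, IsPathTo G t l → pathSource G t l = u →
      ∃ m ∈ c.support, ∃ n, l <+: (List.replicate n m).flatten := by
    intro t l hl hlu
    obtain ⟨m, hm, hml⟩ := hprefix t l hl hlu
    exact ⟨m, hm, _, prefix_flatten_replicate hml (hc m hm).2⟩
  have hcomp : ∀ t t' l l', IsPathTo G t l → pathSource G t l = u → IsPathTo G t' l' →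
      pathSource G t' l' = u → l <+: l' ∨ l' <+: l := fun t t' l l' h1 h2 h3 h4 =>
    prefix_or_prefix_of_isPathTo c.support (fun m hm => (hc m hm).1) hpower h1 h2 h3 h4
  have hext : ∀ t l, IsPathTo G t l → pathSource G t l = u →
      ∃ m, IsClosedAt G u m ∧ l <+: m := by
    intro t l hl hlu
    obtain ⟨m, hm, n, hn⟩ := hpower t l hl hlu
    exact ⟨_, (hc m hm).1.flatten_replicate n, hn⟩
  -- The empty path shows that the support is nonempty, which provides a nonempty closed path.
  obtain ⟨m₀, hm₀, -⟩ := hprefix u [] trivial rfl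
  obtain ⟨d, hd, hd0, hgen⟩ := exists_closed_generator (G := G) (u := u)
    (fun l l' h h' => hcomp u u l l' h.1 h.2 h'.1 h'.2) ⟨m₀, hc m₀ hm₀⟩
  refine map_ne_zero_of_cycle K hφ hvert hd hd0 (fun x => ?_) hk ?_ hy
  · refine Submodule.span_mono ?_ (vert_mul_mul_vert_mem_span K hext hcomp x)
    rintro _ ⟨l, m, hl, hm, rfl⟩
    obtain ⟨i, rfl⟩ := hgen l hl
    obtain ⟨j, rfl⟩ := hgen m hm
    exact ⟨i, j, rfl⟩
  · rw [Finsupp.linearCombination_apply]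
    refine Submodule.sum_mem _ fun m hm => Submodule.smul_mem _ _ (Submodule.subset_span ?_)
    obtain ⟨i, hi⟩ := hgen m (hc m hm).1
    cases i with
    | zero => exact absurd (by simpa using hi) (hc m hm).2
    | succ i => exact ⟨i, by rw [hi]⟩

end Corner

end LeavittPathAlgebra

namespace LeavittPathAlgebra

/-! ### The endomorphisms `φ_{P,Q}`. -/

section Endomorphisms

variable {K : Type uK} [Field K] {V : Type uV} {E : Type uE} {G : DirectedGraph V E}

theorem IsPhi.unique {n : ℕ} {e : Fin n → E}
    {P Q : Matrix (Fin n) (Fin n) (LeavittPathAlgebra K G)}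
    {φ ψ : LeavittPathAlgebra K G →ₙₐ[K] LeavittPathAlgebra K G} (hφ : IsPhi e P Q φ)
    (hψ : IsPhi e P Q ψ) : φ = ψ := by
  refine hom_ext (fun u => ?_) (fun f => ?_) (fun f => ?_)
  · rw [hφ.map_vert, hψ.map_vert]
  · by_cases hf : f ∈ Set.range e
    · obtain ⟨i, rfl⟩ := hf
      rw [hφ.map_edge_apply, hψ.map_edge_apply]
    · rw [hφ.map_edge f hf, hψ.map_edge f hf]
  · by_cases hf : f ∈ Set.range e
    · obtain ⟨i, rfl⟩ := hf
      rw [hφ.map_ghost_apply, hψ.map_ghost_apply]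
    · rw [hφ.map_ghost f hf, hψ.map_ghost f hf]

theorem commute_of_scalarMatrix_commute {n : ℕ} {w : LeavittPathAlgebra K G}
    {P : Matrix (Fin n) (Fin n) (LeavittPathAlgebra K G)}
    (h : scalarMatrix n w * P = P * scalarMatrix n w) (i j : Fin n) : w * P i j = P i j * w := by
  simpa [scalarMatrix, Matrix.diagonal_mul, Matrix.mul_diagonal] using congrFun (congrFun h i) j

theorem sum_mul_eq_of_scalarMatrix_mul {n : ℕ} {w : LeavittPathAlgebra K G}
    {P Q : Matrix (Fin n) (Fin n) (LeavittPathAlgebra K G)}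
    (h : scalarMatrix n w * P * Q = scalarMatrix n w) (i j : Fin n) :
    w * ∑ k, P i k * Q k j = if i = j then w else 0 := by
  rw [mul_assoc] at h
  simpa [scalarMatrix, Matrix.diagonal_mul, Matrix.diagonal_apply, Matrix.mul_apply] using
    congrFun (congrFun h i) j

/-- The images of `e_i*` and `e_j` multiply to the `(i, j)` entry of `wQP`, which gives (3). Summing
image of `e_i` times image of `e_i*` over `i` puts the entries of `wPQ` between `e_k` and `e_l*`,
which gives (4). Commutation with `w` gives (2). -/
theorem exists_isPhi {n : ℕ} {v w : V} {e : Fin n → E} (he : Function.Injective e)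
    (hs : ∀ i, G.s (e i) = v) (hr : ∀ i, G.r (e i) = w)
    {P Q : Matrix (Fin n) (Fin n) (LeavittPathAlgebra K G)}
    (hP : ∀ i j, vert K G w * P i j = P i j * vert K G w)
    (hQ : ∀ i j, vert K G w * Q i j = Q i j * vert K G w)
    (hPQ : ∀ i j, vert K G w * ∑ k, P i k * Q k j = if i = j then vert K G w else 0)
    (hQP : ∀ i j, vert K G w * ∑ k, Q i k * P k j = if i = j then vert K G w else 0) :
    ∃ φ : LeavittPathAlgebra K G →ₙₐ[K] LeavittPathAlgebra K G, IsPhi e P Q φ := by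
  classical
  have hew : ∀ k, edge K G (e k) * vert K G w = edge K G (e k) := fun k => by
    rw [← hr k, edge_mul_vert_range]
  have hwg : ∀ k, vert K G w * ghost K G (e k) = ghost K G (e k) := fun k => by
    rw [← hr k, vert_range_mul_ghost]
  have hve : ∀ k, vert K G v * edge K G (e k) = edge K G (e k) := fun k => by
    rw [← hs k, vert_source_mul_edge]
  have hgv : ∀ k, ghost K G (e k) * vert K G v = ghost K G (e k) := fun k => by
    rw [← hs k, ghost_mul_vert_source]
  let a : E → LeavittPathAlgebra K G := fun f =>
    if h : ∃ i, e i = f then ∑ k, edge K G (e k) * P k h.choose else edge K G f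
  let b : E → LeavittPathAlgebra K G := fun f =>
    if h : ∃ i, e i = f then ∑ k, Q h.choose k * ghost K G (e k) else ghost K G f
  have ha : ∀ i, a (e i) = ∑ k, edge K G (e k) * P k i := fun i => by
    have h : ∃ j, e j = e i := ⟨i, rfl⟩
    simp only [a, dif_pos h, he h.choose_spec]
  have hb : ∀ i, b (e i) = ∑ k, Q i k * ghost K G (e k) := fun i => by
    have h : ∃ j, e j = e i := ⟨i, rfl⟩
    simp only [b, dif_pos h, he h.choose_spec]
  have ha' : ∀ f, f ∉ Set.range e → a f = edge K G f := fun f hf => dif_neg hf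
  have hb' : ∀ f, f ∉ Set.range e → b f = ghost K G f := fun f hf => dif_neg hf
  have hghost_sum : ∀ i, ∀ x : Fin n → LeavittPathAlgebra K G,
      ghost K G (e i) * ∑ k, edge K G (e k) * x k = vert K G w * x i := fun i x => by
    rw [Finset.mul_sum, Finset.sum_eq_single i]
    · rw [← mul_assoc, ghost_mul_edge_self, hr]
    · intro k _ hk
      rw [← mul_assoc, ghost_mul_edge_of_ne K G fun h => hk (he h).symm, zero_mul]
    · exact fun h => absurd (Finset.mem_univ i) h
  let F : LeavittFamily G (LeavittPathAlgebra K G) :=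
    { vert := vert K G
      edge := a
      ghost := b
      vert_mul_self := vert_mul_vert_self K G
      vert_mul_of_ne := fun _ _ h => vert_mul_vert_of_ne K G h
      source_mul := fun f => by
        by_cases hf : f ∈ Set.range e
        · obtain ⟨i, rfl⟩ := hf
          simp only [ha, hs, Finset.mul_sum, ← mul_assoc, hve]
        · rw [ha' f hf, vert_source_mul_edge]
      mul_range := fun f => by
        by_cases hf : f ∈ Set.range e
        · obtain ⟨i, rfl⟩ := hf
          simp only [ha, hr, Finset.sum_mul, mul_assoc, ← hP]
          simp only [← mul_assoc, hew]
        · rw [ha' f hf, edge_mul_vert_range]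
      ghost_mul_source := fun f => by
        by_cases hf : f ∈ Set.range e
        · obtain ⟨i, rfl⟩ := hf
          simp only [hb, hs, Finset.sum_mul, mul_assoc, hgv]
        · rw [hb' f hf, ghost_mul_vert_source]
      range_mul_ghost := fun f => by
        by_cases hf : f ∈ Set.range e
        · obtain ⟨i, rfl⟩ := hf
          simp only [hb, hr, Finset.mul_sum, ← mul_assoc, hQ]
          simp only [mul_assoc, hwg]
        · rw [hb' f hf, vert_range_mul_ghost]
      ghost_mul_self := fun f => by
        by_cases hf : f ∈ Set.range e
        · obtain ⟨i, rfl⟩ := hf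
          rw [ha, hb, hr, Finset.sum_mul]
          simp only [mul_assoc, hghost_sum]
          simp only [← mul_assoc, ← hQ]
          simp only [mul_assoc, ← Finset.mul_sum, hQP, if_true]
        · rw [ha' f hf, hb' f hf, ghost_mul_edge_self]
      ghost_mul_of_ne := fun f f' hne => by
        by_cases hf : f ∈ Set.range e
        · obtain ⟨i, rfl⟩ := hf
          rw [hb, Finset.sum_mul]
          by_cases hf' : f' ∈ Set.range e
          · obtain ⟨j, rfl⟩ := hf'
            rw [ha]
            simp only [mul_assoc, hghost_sum]
            simp only [← mul_assoc, ← hQ]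
            simp only [mul_assoc, ← Finset.mul_sum, hQP]
            rw [if_neg fun h => hne (congrArg e h)]
          · rw [ha' f' hf']
            refine Finset.sum_eq_zero fun k _ => ?_
            rw [mul_assoc, ghost_mul_edge_of_ne K G fun h => hf' ⟨k, h⟩, mul_zero]
        · rw [hb' f hf]
          by_cases hf' : f' ∈ Set.range e
          · obtain ⟨j, rfl⟩ := hf'
            rw [ha, Finset.mul_sum]
            refine Finset.sum_eq_zero fun k _ => ?_
            rw [← mul_assoc, ghost_mul_edge_of_ne K G fun h => hf ⟨k, h.symm⟩, zero_mul]
          · rw [ha' f' hf', ghost_mul_edge_of_ne K G hne]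
      vert_eq_sum := fun u hne hfin => by
        rw [LeavittPathAlgebra.vert_eq_sum K G u hne hfin]
        by_cases hu : u = v
        · subst hu
          have hsub : Finset.univ.map ⟨e, he⟩ ⊆ hfin.toFinset := by
            intro f hf
            obtain ⟨i, -, rfl⟩ := Finset.mem_map.mp hf
            simpa using hs i
          -- The `e_i` need not be all edges from `v`; the other summands do not change.
          rw [← Finset.sum_sdiff hsub, ← Finset.sum_sdiff hsub]
          congr 1
          · refine Finset.sum_congr rfl fun f hf => ?_
            have hf' : f ∉ Set.range e := by
              rintro ⟨i, rfl⟩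
              simp at hf
            rw [ha' f hf', hb' f hf']
          · rw [Finset.sum_map, Finset.sum_map]
            simp only [Function.Embedding.coeFn_mk, ha, hb, Finset.sum_mul, Finset.mul_sum]
            rw [Finset.sum_comm]
            refine Finset.sum_congr rfl fun k _ => ?_
            rw [Finset.sum_comm]
            have hterm : ∀ l, ∑ i, edge K G (e l) * P l i * (Q i k * ghost K G (e k)) =
                edge K G (e l) * (if l = k then vert K G w else 0) * ghost K G (e k) := by
              intro l
              rw [← hPQ, ← mul_assoc, hew, Finset.mul_sum, Finset.sum_mul]
              simp only [mul_assoc]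
            refine Eq.symm ((Finset.sum_congr rfl fun l _ => hterm l).trans ?_)
            rw [Finset.sum_eq_single k]
            · rw [if_pos rfl, hew]
            · intro l _ hl
              rw [if_neg hl, mul_zero, zero_mul]
            · exact fun h => absurd (Finset.mem_univ k) h
        · refine Finset.sum_congr rfl fun f hf => ?_
          have hf' : f ∉ Set.range e := by
            rintro ⟨i, rfl⟩
            have : G.s (e i) = u := by simpa using hf
            exact hu (this.symm.trans (hs i))
          rw [ha' f hf', hb' f hf'] }
  exact ⟨F.lift K, F.lift_vert, fun f hf => (F.lift_edge f).trans (ha' f hf),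
    fun f hf => (F.lift_ghost f).trans (hb' f hf), fun i => (F.lift_edge (e i)).trans (ha i),
    fun i => (F.lift_ghost (e i)).trans (hb i)⟩

/-- If a homomorphism fixes a corner idempotent and the entries of a matrix in the corner, it fixes
the entries of the inverse matrix. -/
theorem map_inverse_entry {n : ℕ} {w : LeavittPathAlgebra K G} (hw : w * w = w)
    {P Q : Matrix (Fin n) (Fin n) (LeavittPathAlgebra K G)}
    (hQ : ∀ i j, w * Q i j = Q i j * w)
    (hPQ : ∀ i j, w * ∑ k, P i k * Q k j = if i = j then w else 0)
    (hQP : ∀ i j, w * ∑ k, Q i k * P k j = if i = j then w else 0)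
    {φ : LeavittPathAlgebra K G →ₙₐ[K] LeavittPathAlgebra K G} (hφw : φ w = w)
    (hφ : ∀ i j, w * φ (P i j) = w * P i j) (i j : Fin n) : w * φ (Q i j) = w * Q i j := by
  -- Over the corner, applying `φ` to `PQ = w` gives `P φ(Q) = w`. Multiplication by `Q` on the left
  -- then gives `φ(Q) = Q`.
  have h1 : ∀ k, w * ∑ l, P k l * φ (Q l j) = if k = j then w else 0 := by
    intro k
    have h := congrArg φ (hPQ k j)
    rw [map_mul, map_sum, hφw, Finset.mul_sum] at h
    simp only [map_mul, ← mul_assoc, hφ] at h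
    simp only [Finset.mul_sum, ← mul_assoc]
    rw [h]
    split_ifs
    · exact hφw
    · exact map_zero φ
  have h2 : ∑ k, w * Q i k * (w * ∑ l, P k l * φ (Q l j)) = w * φ (Q i j) := by
    have h3 : ∀ k, w * Q i k * (w * ∑ l, P k l * φ (Q l j)) =
        ∑ l, w * (Q i k * P k l) * φ (Q l j) := by
      intro k
      rw [← mul_assoc, mul_assoc w, ← hQ, ← mul_assoc, hw, Finset.mul_sum]
      simp only [mul_assoc]
    simp only [h3]
    rw [Finset.sum_comm]
    simp only [← Finset.sum_mul, ← Finset.mul_sum, hQP]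
    rw [Finset.sum_eq_single i]
    · rw [if_pos rfl]
    · intro l _ hl
      rw [if_neg (Ne.symm hl), zero_mul]
    · exact fun h => absurd (Finset.mem_univ i) h
  rw [← h2]
  simp only [h1]
  rw [Finset.sum_eq_single j]
  · rw [if_pos rfl, mul_assoc, ← hQ, ← mul_assoc, hw]
  · intro k _ hk
    rw [if_neg hk, mul_zero]
  · exact fun h => absurd (Finset.mem_univ j) h

/-- On edges the composite involves `P φ(Q)`, on ghost edges `φ(P) Q`. Both become `PQ`, so both
matrices must be fixed even for this one composite. -/
theorem IsPhi.comp_eq_id {n : ℕ} {w : V} {e : Fin n → E} (hr : ∀ i, G.r (e i) = w)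
    {P Q : Matrix (Fin n) (Fin n) (LeavittPathAlgebra K G)}
    (hP : ∀ i j, vert K G w * P i j = P i j * vert K G w)
    (hQ : ∀ i j, vert K G w * Q i j = Q i j * vert K G w)
    (hPQ : ∀ i j, vert K G w * ∑ k, P i k * Q k j = if i = j then vert K G w else 0)
    {φ ψ : LeavittPathAlgebra K G →ₙₐ[K] LeavittPathAlgebra K G} (hφ : IsPhi e P Q φ)
    (hψ : IsPhi e Q P ψ) (hφP : ∀ i j, vert K G w * φ (P i j) = vert K G w * P i j)
    (hφQ : ∀ i j, vert K G w * φ (Q i j) = vert K G w * Q i j) :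
    φ.comp ψ = NonUnitalAlgHom.id K (LeavittPathAlgebra K G) := by
  have hew : ∀ k, edge K G (e k) * vert K G w = edge K G (e k) := fun k => by
    rw [← hr k, edge_mul_vert_range]
  have hwg : ∀ k, vert K G w * ghost K G (e k) = ghost K G (e k) := fun k => by
    rw [← hr k, vert_range_mul_ghost]
  refine hom_ext (fun u => ?_) (fun f => ?_) (fun f => ?_)
  · rw [NonUnitalAlgHom.comp_apply, hψ.map_vert, hφ.map_vert]; rfl
  · rw [NonUnitalAlgHom.comp_apply]
    change _ = edge K G f
    by_cases hf : f ∈ Set.range e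
    · obtain ⟨i, rfl⟩ := hf
      have h1 : ∀ k l, edge K G (e l) * P l k * φ (Q k i) = edge K G (e l) * (P l k * Q k i) := by
        intro k l
        rw [← hew l, mul_assoc _ _ (P l k), hP, mul_assoc, mul_assoc, hφQ, ← mul_assoc (P l k),
          ← hP, mul_assoc, mul_assoc]
      simp only [hψ.map_edge_apply, map_sum, map_mul, hφ.map_edge_apply, Finset.sum_mul, h1]
      rw [Finset.sum_comm]
      simp only [← Finset.mul_sum]
      rw [Finset.sum_eq_single i]
      · rw [← hew i, mul_assoc, hPQ, if_pos rfl]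
      · intro l _ hl
        rw [← hew l, mul_assoc, hPQ, if_neg hl, mul_zero]
      · exact fun h => absurd (Finset.mem_univ i) h
    · rw [hψ.map_edge f hf, hφ.map_edge f hf]
  · rw [NonUnitalAlgHom.comp_apply]
    change _ = ghost K G f
    by_cases hf : f ∈ Set.range e
    · obtain ⟨i, rfl⟩ := hf
      -- The hypothesis has `w` on the left; `w` changes sides inside `φ`, where it commutes with `P
      -- i k`.
      have h0 : ∀ k, φ (P i k) * vert K G w = vert K G w * P i k := by
        intro k
        rw [← hφP, ← hφ.map_vert w, ← map_mul, ← map_mul, hP]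
      have h1 : ∀ k l, φ (P i k) * (Q k l * ghost K G (e l)) =
          vert K G w * (P i k * Q k l) * ghost K G (e l) := by
        intro k l
        rw [← hwg l, ← mul_assoc (Q k l), ← hQ, mul_assoc (vert K G w), ← mul_assoc, h0, hwg]
        simp only [mul_assoc]
      simp only [hψ.map_ghost_apply, map_sum, map_mul, hφ.map_ghost_apply, Finset.mul_sum, h1]
      rw [Finset.sum_comm]
      simp only [← Finset.sum_mul, ← Finset.mul_sum, hPQ]
      rw [Finset.sum_eq_single i]
      · rw [if_pos rfl, hwg]
      · intro l _ hl
        rw [if_neg (Ne.symm hl), zero_mul]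
      · exact fun h => absurd (Finset.mem_univ i) h
    · rw [hψ.map_ghost f hf, hφ.map_ghost f hf]

end Endomorphisms

end LeavittPathAlgebra

open LeavittPathAlgebra in
theorem mainTheorem3 {K : Type uK} [Field K] {V : Type uV} {E : Type uE} (G : DirectedGraph V E)
    (n : ℕ) (hn : 0 < n) (v w : V) (e : Fin n → E) (he : Function.Injective e)
    (hs : ∀ i, G.s (e i) = v) (hr : ∀ i, G.r (e i) = w)
    (P Q : Matrix (Fin n) (Fin n) (LeavittPathAlgebra K G))
    (hwP : scalarMatrix n (vert K G w) * P = P * scalarMatrix n (vert K G w))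
    (hwQ : scalarMatrix n (vert K G w) * Q = Q * scalarMatrix n (vert K G w))
    (hPQ : scalarMatrix n (vert K G w) * P * Q = scalarMatrix n (vert K G w))
    (hQP : scalarMatrix n (vert K G w) * Q * P = scalarMatrix n (vert K G w)) :
    (∃! φ : LeavittPathAlgebra K G →ₙₐ[K] LeavittPathAlgebra K G, IsPhi e P Q φ) ∧
    (∃! ψ : LeavittPathAlgebra K G →ₙₐ[K] LeavittPathAlgebra K G, IsPhi e Q P ψ) ∧
    ∀ φ ψ : LeavittPathAlgebra K G →ₙₐ[K] LeavittPathAlgebra K G,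
      IsPhi e P Q φ → IsPhi e Q P ψ →
      ((∀ i j, vert K G w * φ (P i j) = vert K G w * P i j) ∨
        (∀ i j, vert K G w * φ (Q i j) = vert K G w * Q i j)) →
      Function.Bijective φ ∧
        φ.comp ψ = NonUnitalAlgHom.id K (LeavittPathAlgebra K G) ∧
        ψ.comp φ = NonUnitalAlgHom.id K (LeavittPathAlgebra K G) := by
  have hP := commute_of_scalarMatrix_commute hwP
  have hQ := commute_of_scalarMatrix_commute hwQ
  have hPQ' := sum_mul_eq_of_scalarMatrix_mul hPQ
  have hQP' := sum_mul_eq_of_scalarMatrix_mul hQP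
  obtain ⟨φ₀, hφ₀⟩ := exists_isPhi he hs hr hP hQ hPQ' hQP'
  obtain ⟨ψ₀, hψ₀⟩ := exists_isPhi he hs hr hQ hP hQP' hPQ'
  refine ⟨⟨φ₀, hφ₀, fun _ h => h.unique hφ₀⟩, ⟨ψ₀, hψ₀, fun _ h => h.unique hψ₀⟩, ?_⟩
  intro φ ψ hφ hψ hfix
  have hw := vert_mul_vert_self K G w
  have hboth : (∀ i j, vert K G w * φ (P i j) = vert K G w * P i j) ∧
      ∀ i j, vert K G w * φ (Q i j) = vert K G w * Q i j := by
    rcases hfix with h | h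
    · exact ⟨h, map_inverse_entry hw hQ hPQ' hQP' (hφ.map_vert w) h⟩
    · exact ⟨map_inverse_entry hw hP hQP' hPQ' (hφ.map_vert w) h, h⟩
  have hcomp := hφ.comp_eq_id hr hP hQ hPQ' hψ hboth.1 hboth.2
  have hright : ∀ x, φ (ψ x) = x := fun x => DFunLike.congr_fun hcomp x
  have hsurj : Function.Surjective φ := fun x => ⟨ψ x, hright x⟩
  -- No hypothesis describes `ψ` on the entries, so the left inverse is obtained from injectivity
  -- and not by the symmetric computation.
  have hinj := injective_of_surjective K hsurj hφ.map_vert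
  refine ⟨⟨hinj, hsurj⟩, hcomp, ?_⟩
  ext x
  exact hinj (hright (φ x))
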